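/- \textbf{Theorem (Subspace logarithmic Sobolev inequality).} Let $\Gamma\in\mathbb{R}^{d\times d}$ be a symmetric positive definite matrix and let $\kappa\ge 1$. Let $\mu$ be a probability measure on $\mathbb{R}^d$ which has a Lebesgue density proportional to $\exp(-V-\Psi)$, where $V:\mathbb{R}^d\to\mathbb{R}$ is twice continuously differentiable with $\nabla^2 V(x)-\Gamma$ positive semidefinite for every $x\in\mathbb{R}^d$, and $\Psi:\mathbb{R}^d\to\mathbb{R}$ is a bounded measurable function with $\exp(\sup\Psi-\inf\Psi)\le\kappa$. Write $\|v\|_{\Gamma^{-1}}^2=v^T\Gamma^{-1}v$. Let $P_r\in\mathbb{R}^{d\times d}$ be any projector, i.e. $P_r^2=P_r$ (not necessarily symmetric), let $\sigma(P_r)=\{P_r^{-1}(B): B\subseteq\mathbb{R}^d \text{ Borel}\}$ be the $\sigma$-algebra generated by $x\mapsto P_rx$, and let $\mathbb{E}_\mu(\,\cdot\,|\sigma(P_r))$ denote conditional expectation under $\mu$. Then, for every continuously differentiable function $h:\mathbb{R}^d\to\mathbb{R}$ with $\int\|\nabla h\|_{\Gamma^{-1}}^2\,\mathrm{d}\mu<\infty$,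 the function $h^2$ is $\mu$-integrable (so that $\mathbb{E}_\mu(h^2|\sigma(P_r))$ is well defined), both integrands below are $\mu$-integrable (with the convention that $h^2\log\frac{h^2}{\mathbb{E}_\mu(h^2|\sigma(P_r))}=0$ where $h=0$), and $$\int h^2\log\frac{h^2}{\mathbb{E}_\mu(h^2|\sigma(P_r))}\,\mathrm{d}\mu\ \le\ 2\kappa\int\|(I_d-P_r^T)\nabla h\|_{\Gamma^{-1}}^2\,\mathrm{d}\mu .$$ -/

import Mathlib

open MeasureTheory
open scoped Matrix Gradient

noncomputable section

/-- The linear map `x ↦ P x` on Euclidean space given by a square matrix `P`. -/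
def matrixMap {d : ℕ} (P : Matrix (Fin d) (Fin d) ℝ) (x : EuclideanSpace ℝ (Fin d)) :
    EuclideanSpace ℝ (Fin d) :=
  WithLp.toLp 2 (P *ᵥ x.ofLp)

/-- The squared norm `‖v‖²_A = vᵀ A v`. -/
def sqNormWith {d : ℕ} (A : Matrix (Fin d) (Fin d) ℝ) (v : EuclideanSpace ℝ (Fin d)) : ℝ :=
  v.ofLp ⬝ᵥ (A *ᵥ v.ofLp)

/-- The Hessian matrix `∇²V(x)`, with entries `∂ᵢ∂ⱼ V(x)`. -/
def hessianMatrix {d : ℕ} (V : EuclideanSpace ℝ (Fin d) → ℝ) (x : EuclideanSpace ℝ (Fin d)) :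
    Matrix (Fin d) (Fin d) ℝ :=
  Matrix.of fun i j =>
    fderiv ℝ (fun y => fderiv ℝ V y (EuclideanSpace.single j 1)) x (EuclideanSpace.single i 1)

/-- `σ(P)`, the σ-algebra of the preimages `P⁻¹(B)` of the Borel sets `B`. -/
abbrev sigmaOf {d : ℕ} (P : Matrix (Fin d) (Fin d) ℝ) :
    MeasurableSpace (EuclideanSpace ℝ (Fin d)) :=
  MeasurableSpace.comap (matrixMap P) inferInstance

/-- `μ` has a Lebesgue density proportional to `exp (-V - Ψ)`, where `V` is twice continuously
differentiable with `∇²V ⪰ Γ` everywhere for the symmetric positive definite matrix `Γ`, and `Ψ`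
is bounded with `exp (sup Ψ - inf Ψ) ≤ κ`. -/
structure IsPerturbedStronglyLogConcave {d : ℕ} (μ : Measure (EuclideanSpace ℝ (Fin d)))
    (V Ψ : EuclideanSpace ℝ (Fin d) → ℝ) (Γ : Matrix (Fin d) (Fin d) ℝ) (κ : ℝ) : Prop where
  posDef : Γ.PosDef
  contDiff : ContDiff ℝ 2 V
  hessian_ge : ∀ x, (hessianMatrix V x - Γ).PosSemidef
  aemeasurable : AEMeasurable Ψ volume
  bddAbove : BddAbove (Set.range Ψ)
  bddBelow : BddBelow (Set.range Ψ)
  exp_osc_le : Real.exp ((⨆ x, Ψ x) - ⨅ x, Ψ x) ≤ κ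
  density : ∃ c : ℝ, 0 < c ∧
    μ = volume.withDensity fun x => ENNReal.ofReal (c * Real.exp (-V x - Ψ x))

end

/-!
The inequality is a conditional form of the logarithmic Sobolev inequality for strongly log-concave
measures. Everything is phrased through the nonnegative integrand
`entDensity a m = a log (a / m) - a + m`.

The inequality for a measure with density `exp (-W)`, with `W` strongly convex on a Euclidean space
of any dimension, follows the argument of Bobkov and Ledoux. The Prékopa–Leindler inequality
(`prekopaLeindler_euclideanSpace`) with weights `1 - s` and `s`, applied to
`exp (g / (1 - s) - W)` and `exp (-W)`, compares `∫ exp (g / (1 - s))` with the integral of the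
exponential of the Hopf–Lax regularisation of `g` at time `s / (1 - s)`; the terms of first order
in `s` give `∫ g exp g ≤ ½ ∫ ‖g'‖² exp g` for normalised `exp g`
(`integral_mul_exp_le_of_strongConvexOn`). Taking `exp g` proportional to `δ + f²` with `f`
compactly supported, and then truncating a general `f`, gives
`integrable_sq_and_lintegral_entDensity_le`, which includes the integrability of `f²`.

Along each affine subspace parallel to the kernel of the projector `P`, the potential `V` is
strongly convex for the restriction of `Γ` (`strongConvexOn_comp_add_linearMap`), and the derivative
of `h` is controlled by `‖(1 - Pᵀ) ∇h‖_{Γ⁻¹}` (`norm_fderiv_comp_add_linearMap_sq_le`). Integrating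
over these fibres bounds `∫ entDensity (h²) G exp (-V)`, where `G` is the mean of `h²` over the
fibre under the unperturbed density `exp (-V)` (`exists_measurable_lintegral_entDensity_le`).

Finally, among all `σ(P)`-measurable functions the conditional expectation `𝔼_μ(h² | σ(P))`
minimises `∫ entDensity (h²) (·) dμ` (`lintegral_entDensity_condExp_le`), so it may be replaced by
`G`. This is the Holley–Stroock argument: since `entDensity` is nonnegative, passing from `μ` to
`exp (-V)` and back costs only the factor `exp (sup Ψ - inf Ψ) ≤ κ`, and no description of the
conditional expectation under `μ` is needed.
-/

/-! ### The Prékopa–Leindler inequality -/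

open Set in
open scoped Pointwise in
/-- The Brunn–Minkowski inequality on the line, for compact sets: the translates of `A` by the
minimum of `B` and of `B` by the maximum of `A` lie in `A + B` and share at most one point. -/
theorem volume_add_le_volume_add_of_isCompact {A B : Set ℝ} (hA : IsCompact A) (hB : IsCompact B)
    (hA0 : A.Nonempty) (hB0 : B.Nonempty) : volume A + volume B ≤ volume (A + B) := by
  obtain ⟨a, ha, hamax⟩ := hA.exists_isGreatest hA0
  obtain ⟨b, hb, hbmin⟩ := hB.exists_isLeast hB0
  have h1 : volume ((fun x => x + b) '' A) = volume A := by
    simp [image_add_right, measure_preimage_add_right]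
  have h2 : volume ((fun x => a + x) '' B) = volume B := by
    simp [image_add_left, measure_preimage_add]
  have hdisj : AEDisjoint volume ((fun x => x + b) '' A) ((fun x => a + x) '' B) := by
    refine measure_mono_null (t := {a + b}) ?_ (by simp)
    rintro _ ⟨⟨x, hx, rfl⟩, ⟨y, hy, hxy⟩⟩
    have := hamax hx
    have := hbmin hy
    simp only [mem_singleton_iff] at *
    linarith
  have hmeas : NullMeasurableSet ((fun x => a + x) '' B) volume :=
    (hB.image (by fun_prop)).measurableSet.nullMeasurableSet
  rw [← h1, ← h2, ← measure_union₀ hmeas hdisj]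
  refine measure_mono (union_subset ?_ ?_)
  · rintro _ ⟨x, hx, rfl⟩
    exact add_mem_add hx hb
  · rintro _ ⟨x, hx, rfl⟩
    exact add_mem_add ha hx

open Set in
open scoped Pointwise in
theorem smul_volume_add_smul_volume_le {t s : ℝ} (ht : 0 < t) (hs : 0 < s) {A B C : Set ℝ}
    (hA : MeasurableSet A) (hB : MeasurableSet B) (hA0 : A.Nonempty) (hB0 : B.Nonempty)
    (h : ∀ a ∈ A, ∀ b ∈ B, t * a + s * b ∈ C) :
    ENNReal.ofReal t * volume A + ENNReal.ofReal s * volume B ≤ volume C := by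
  rw [hA.measure_eq_iSup_isCompact, hB.measure_eq_iSup_isCompact]
  simp only [ENNReal.mul_iSup]
  obtain ⟨a, ha⟩ := hA0
  obtain ⟨b, hb⟩ := hB0
  simp_rw [iSup_and']
  refine ENNReal.biSup_add_biSup_le' ⟨∅, empty_subset _, isCompact_empty⟩
    ⟨∅, empty_subset _, isCompact_empty⟩ fun K ⟨hKA, hK⟩ K' ⟨hKB, hK'⟩ => ?_
  have hc1 : IsCompact (t • insert a K) := (hK.insert a).smul t
  have hc2 : IsCompact (s • insert b K') := (hK'.insert b).smul s
  calc ENNReal.ofReal t * volume K + ENNReal.ofReal s * volume K'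
      ≤ ENNReal.ofReal t * volume (insert a K) + ENNReal.ofReal s * volume (insert b K') := by
        gcongr <;> exact subset_insert _ _
    _ = volume (t • insert a K) + volume (s • insert b K') := by
        simp [Measure.addHaar_smul, abs_of_pos ht, abs_of_pos hs]
    _ ≤ volume (t • insert a K + s • insert b K') :=
        volume_add_le_volume_add_of_isCompact hc1 hc2 (insert_nonempty _ _).smul_set
          (insert_nonempty _ _).smul_set
    _ ≤ volume C := by
        refine measure_mono ?_
        rintro _ ⟨_, ⟨x, hx, rfl⟩, _, ⟨y, hy, rfl⟩, rfl⟩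
        refine h x ?_ y ?_
        · rcases hx with rfl | hx
          exacts [ha, hKA hx]
        · rcases hy with rfl | hy
          exacts [hb, hKB hy]

open Set in
theorem lintegral_eq_lintegral_Ioo_meas_lt {u : ℝ → ENNReal} (hu : Measurable u)
    (hu1 : ∀ x, u x ≤ 1) :
    ∫⁻ x, u x = ∫⁻ l in Ioo (0 : ℝ) 1, volume {x | ENNReal.ofReal l < u x} := by
  have hfin : ∀ x, u x ≠ ⊤ := fun x => ((hu1 x).trans_lt ENNReal.one_lt_top).ne
  calc ∫⁻ x, u x = ∫⁻ x, ENNReal.ofReal (u x).toReal := by simp [ENNReal.ofReal_toReal, hfin]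
    _ = ∫⁻ l in Ioi (0 : ℝ), volume {x | l < (u x).toReal} :=
        lintegral_eq_lintegral_meas_lt _ (.of_forall fun x => ENNReal.toReal_nonneg)
          hu.ennreal_toReal.aemeasurable
    _ = ∫⁻ l in Ioi (0 : ℝ), (Iio 1).indicator
          (fun l => volume {x | ENNReal.ofReal l < u x}) l := by
        refine setLIntegral_congr_fun measurableSet_Ioi fun l hl => ?_
        by_cases h1 : l < 1
        · simp only [indicator, mem_Iio, h1, if_true]
          congr 1
          ext x
          exact (ENNReal.ofReal_lt_iff_lt_toReal (le_of_lt hl) (hfin x)).symm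
        · simp only [indicator, mem_Iio, h1, if_false]
          have : {x | l < (u x).toReal} = ∅ := by
            ext x
            have := ENNReal.toReal_mono ENNReal.one_ne_top (hu1 x)
            simp only [ENNReal.toReal_one] at this
            simp only [mem_ofPred_eq, mem_empty_iff_false, iff_false]
            linarith
          simp [this]
    _ = _ := by
        rw [lintegral_indicator measurableSet_Iio, Measure.restrict_restrict measurableSet_Iio,
          Iio_inter_Ioi]

open Set in
/-- The one-dimensional inequality for functions with supremum `1`: every superlevel set of `w`
of height below `1` contains the weighted Minkowski sum of the (nonempty) superlevel sets of `u`
and `v`. -/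
theorem lintegral_add_lintegral_le_of_iSup_eq_one {t s : ℝ} (ht : 0 < t) (hs : 0 < s)
    (hts : t + s = 1) {u v w : ℝ → ENNReal} (hu : Measurable u) (hv : Measurable v)
    (hw : Measurable w) (hu1 : ⨆ x, u x = 1) (hv1 : ⨆ x, v x = 1)
    (h : ∀ x y, u x ^ t * v y ^ s ≤ w (t * x + s * y)) :
    ENNReal.ofReal t * (∫⁻ x, u x) + ENNReal.ofReal s * (∫⁻ x, v x) ≤ ∫⁻ x, w x := by
  have hule : ∀ x, u x ≤ 1 := fun x => hu1 ▸ le_iSup u x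
  have hvle : ∀ x, v x ≤ 1 := fun x => hv1 ▸ le_iSup v x
  have hmeas : ∀ f : ℝ → ENNReal, Measurable fun l : ℝ => volume {x | ENNReal.ofReal l < f x} :=
    fun f => Antitone.measurable fun l l' hl => measure_mono fun x hx =>
      (ENNReal.ofReal_le_ofReal hl).trans_lt hx
  calc ENNReal.ofReal t * (∫⁻ x, u x) + ENNReal.ofReal s * (∫⁻ x, v x)
      = ∫⁻ l in Ioo (0 : ℝ) 1, (ENNReal.ofReal t * volume {x | ENNReal.ofReal l < u x} +
          ENNReal.ofReal s * volume {x | ENNReal.ofReal l < v x}) := by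
        rw [lintegral_add_left ((hmeas u).const_mul _), lintegral_const_mul _ (hmeas u),
          lintegral_const_mul _ (hmeas v), lintegral_eq_lintegral_Ioo_meas_lt hu hule,
          lintegral_eq_lintegral_Ioo_meas_lt hv hvle]
    _ ≤ ∫⁻ l in Ioo (0 : ℝ) 1, volume {x | ENNReal.ofReal l < min (w x) 1} := by
        refine setLIntegral_mono (hmeas _) fun l hl => ?_
        have hl1 : ENNReal.ofReal l < 1 := by simpa using hl.2
        obtain ⟨x₀, hx₀⟩ := lt_iSup_iff.1 (hu1.symm ▸ hl1)
        obtain ⟨y₀, hy₀⟩ := lt_iSup_iff.1 (hv1.symm ▸ hl1)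
        refine smul_volume_add_smul_volume_le ht hs (hu measurableSet_Ioi) (hv measurableSet_Ioi)
          ⟨x₀, hx₀⟩ ⟨y₀, hy₀⟩ fun x hx y hy => ?_
        refine lt_min (lt_of_lt_of_le ?_ (h x y)) hl1
        have hl0 : ENNReal.ofReal l ≠ 0 := by simpa using hl.1
        calc ENNReal.ofReal l = ENNReal.ofReal l ^ t * ENNReal.ofReal l ^ s := by
              rw [← ENNReal.rpow_add _ _ hl0 ENNReal.ofReal_ne_top, hts, ENNReal.rpow_one]
          _ < u x ^ t * v y ^ s :=
              ENNReal.mul_lt_mul (ENNReal.rpow_lt_rpow hx ht) (ENNReal.rpow_lt_rpow hy hs)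
    _ = ∫⁻ x, min (w x) 1 :=
        (lintegral_eq_lintegral_Ioo_meas_lt (hw.min measurable_const)
          fun x => min_le_right _ _).symm
    _ ≤ ∫⁻ x, w x := lintegral_mono fun x => min_le_left _ _

theorem ENNReal.rpow_mul_rpow_le_add {t s : ℝ} (ht : 0 < t) (hs : 0 < s) (hts : t + s = 1)
    (a b : ENNReal) : a ^ t * b ^ s ≤ ENNReal.ofReal t * a + ENNReal.ofReal s * b := by
  have ht' : ENNReal.ofReal t ≠ 0 := by simpa using ht
  have hs' : ENNReal.ofReal s ≠ 0 := by simpa using hs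
  induction a with
  | top => simp [ENNReal.mul_top ht']
  | coe a =>
    induction b with
    | top => simp [ENNReal.mul_top hs']
    | coe b =>
      rw [← ENNReal.coe_rpow_of_nonneg _ ht.le, ← ENNReal.coe_rpow_of_nonneg _ hs.le]
      have := NNReal.geom_mean_le_arith_mean2_weighted ⟨t, ht.le⟩ ⟨s, hs.le⟩ a b
        (by ext; exact hts)
      rw [ENNReal.ofReal_eq_coe_nnreal ht.le, ENNReal.ofReal_eq_coe_nnreal hs.le]
      exact_mod_cast this

/-- The Prékopa–Leindler inequality with weights `t` and `s` for a measure on a real vector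
space. -/
def PrekopaLeindler {E : Type*} [AddCommGroup E] [Module ℝ E] [MeasurableSpace E]
    (μ : Measure E) (t s : ℝ) : Prop :=
  ∀ ⦃u v w : E → ENNReal⦄, Measurable u → Measurable v → Measurable w →
    (∀ x y, u x ^ t * v y ^ s ≤ w (t • x + s • y)) →
    (∫⁻ x, u x ∂μ) ^ t * (∫⁻ x, v x ∂μ) ^ s ≤ ∫⁻ x, w x ∂μ

theorem prekopaLeindler_real {t s : ℝ} (ht : 0 < t) (hs : 0 < s) (hts : t + s = 1) :
    PrekopaLeindler (volume : Measure ℝ) t s := by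
  -- The bounded case, by scaling both suprema to `1`.
  have hbdd : ∀ u v w : ℝ → ENNReal, Measurable u → Measurable v → Measurable w →
      (⨆ x, u x) ≠ ⊤ → (⨆ x, v x) ≠ ⊤ →
      (∀ x y, u x ^ t * v y ^ s ≤ w (t * x + s * y)) →
      (∫⁻ x, u x) ^ t * (∫⁻ x, v x) ^ s ≤ ∫⁻ x, w x := by
    intro u v w hu hv hw hU hV h
    by_cases hU0 : (⨆ x, u x) = 0
    · have : ∀ x, u x = 0 := by simpa using hU0
      simp [this, ht]
    by_cases hV0 : (⨆ x, v x) = 0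
    · have : ∀ x, v x = 0 := by simpa using hV0
      simp [this, hs]
    set U := ⨆ x, u x
    set V := ⨆ x, v x
    have hc : U ^ t * V ^ s ≠ 0 := by
      simp [hU0, hV0, hU, hV]
    have hc' : U ^ t * V ^ s ≠ ⊤ :=
      ENNReal.mul_ne_top (ENNReal.rpow_ne_top_of_nonneg ht.le hU)
        (ENNReal.rpow_ne_top_of_nonneg hs.le hV)
    have key := lintegral_add_lintegral_le_of_iSup_eq_one ht hs hts
      (u := fun x => U⁻¹ * u x) (v := fun x => V⁻¹ * v x)
      (w := fun x => (U ^ t * V ^ s)⁻¹ * w x) (hu.const_mul _) (hv.const_mul _) (hw.const_mul _)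
      (by rw [← ENNReal.mul_iSup, ENNReal.inv_mul_cancel hU0 hU])
      (by rw [← ENNReal.mul_iSup, ENNReal.inv_mul_cancel hV0 hV])
      (fun x y => by
        rw [ENNReal.mul_rpow_of_nonneg _ _ ht.le, ENNReal.mul_rpow_of_nonneg _ _ hs.le,
          ENNReal.inv_rpow, ENNReal.inv_rpow, mul_mul_mul_comm,
          ENNReal.mul_inv (.inr (ENNReal.rpow_ne_top_of_nonneg hs.le hV))
            (.inl (ENNReal.rpow_ne_top_of_nonneg ht.le hU))]
        exact mul_le_mul_right (h x y) _)
    rw [lintegral_const_mul _ hu, lintegral_const_mul _ hv, lintegral_const_mul _ hw] at key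
    have key2 := (ENNReal.rpow_mul_rpow_le_add ht hs hts _ _).trans key
    rw [ENNReal.mul_rpow_of_nonneg _ _ ht.le, ENNReal.mul_rpow_of_nonneg _ _ hs.le,
      ENNReal.inv_rpow, ENNReal.inv_rpow, mul_mul_mul_comm,
      ← ENNReal.mul_inv (.inr (ENNReal.rpow_ne_top_of_nonneg hs.le hV))
        (.inl (ENNReal.rpow_ne_top_of_nonneg ht.le hU))] at key2
    exact (ENNReal.mul_le_mul_iff_right (ENNReal.inv_ne_zero.2 hc')
      (ENNReal.inv_ne_top.2 hc)).1 key2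
  intro u v w hu hv hw h
  simp only [smul_eq_mul] at h
  -- Truncation at height `n` reduces to the bounded case.
  have htr : ∀ f : ℝ → ENNReal, Measurable f →
      Filter.Tendsto (fun n : ℕ => ∫⁻ x, min (f x) n) Filter.atTop (nhds (∫⁻ x, f x)) := by
    intro f hf
    refine lintegral_tendsto_of_tendsto_of_monotone
      (fun n => (hf.min measurable_const).aemeasurable)
      (.of_forall fun x m n hmn => min_le_min le_rfl (by exact_mod_cast hmn))
      (.of_forall fun x => ?_)
    have : Filter.Tendsto (fun n : ℕ => min (f x) (n : ENNReal)) Filter.atTop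
        (nhds (min (f x) ⊤)) := tendsto_const_nhds.min ENNReal.tendsto_nat_nhds_top
    simpa using this
  have hfin : ∀ (f : ℝ → ENNReal) (n : ℕ), (⨆ x, min (f x) n) ≠ ⊤ := fun f n =>
    ((iSup_le fun x => min_le_right _ _).trans_lt (ENNReal.natCast_lt_top n)).ne
  have hn : ∀ n : ℕ, (∫⁻ x, min (u x) n) ^ t * (∫⁻ x, min (v x) n) ^ s ≤ ∫⁻ x, w x := fun n =>
    hbdd _ _ w (hu.min measurable_const) (hv.min measurable_const) hw (hfin u n) (hfin v n)
      fun x y => le_trans (by gcongr <;> exact min_le_left _ _) (h x y)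
  by_cases hu0 : ∫⁻ x, u x = 0
  · simp [hu0, ht]
  by_cases hv0 : ∫⁻ x, v x = 0
  · simp [hv0, hs]
  refine le_of_tendsto' (ENNReal.Tendsto.mul ((ENNReal.continuous_rpow_const.tendsto _).comp
    (htr u hu)) (.inl ?_) ((ENNReal.continuous_rpow_const.tendsto _).comp (htr v hv)) (.inl ?_)) hn
  · simp [hu0, ht.le]
  · simp [hv0, hs.le]

theorem PrekopaLeindler.prod {E F : Type*} [AddCommGroup E] [Module ℝ E] [MeasurableSpace E]
    [AddCommGroup F] [Module ℝ F] [MeasurableSpace F] {μ : Measure E} {ν : Measure F}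
    [SFinite μ] [SFinite ν] {t s : ℝ} (hμ : PrekopaLeindler μ t s) (hν : PrekopaLeindler ν t s) :
    PrekopaLeindler (μ.prod ν) t s := by
  intro u v w hu hv hw h
  rw [lintegral_prod _ hu.aemeasurable, lintegral_prod _ hv.aemeasurable,
    lintegral_prod _ hw.aemeasurable]
  refine hμ hu.lintegral_prod_right' hv.lintegral_prod_right' hw.lintegral_prod_right'
    fun x y => ?_
  exact hν (hu.comp measurable_prodMk_left) (hv.comp measurable_prodMk_left)
    (hw.comp measurable_prodMk_left) fun x' y' => h (x, x') (y, y')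

theorem PrekopaLeindler.of_measurePreserving {E F : Type*} [AddCommGroup E] [Module ℝ E]
    [MeasurableSpace E] [AddCommGroup F] [Module ℝ F] [MeasurableSpace F] {μ : Measure E}
    {ν : Measure F} {t s : ℝ} (hμ : PrekopaLeindler μ t s) (e : E → F)
    (he : MeasurePreserving e μ ν) (hlin : ∀ x y, e (t • x + s • y) = t • e x + s • e y) :
    PrekopaLeindler ν t s := by
  intro u v w hu hv hw h
  rw [← he.lintegral_comp hu, ← he.lintegral_comp hv, ← he.lintegral_comp hw]
  refine hμ (hu.comp he.measurable) (hv.comp he.measurable) (hw.comp he.measurable) fun x y => ?_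
  simpa only [Function.comp, hlin] using h (e x) (e y)

theorem prekopaLeindler_pi {t s : ℝ} (ht : 0 < t) (hs : 0 < s) (hts : t + s = 1) (n : ℕ) :
    PrekopaLeindler (volume : Measure (Fin n → ℝ)) t s := by
  induction n with
  | zero =>
    intro u v w _ _ _ h
    rw [volume_pi, Measure.pi_of_empty _ (isEmptyElim : Fin 0 → ℝ)]
    simp only [lintegral_dirac]
    convert h isEmptyElim isEmptyElim using 2
  | succ n ih =>
    refine ((prekopaLeindler_real ht hs hts).prod ih).of_measurePreserving _
      (volume_preserving_piFinSuccAbove (fun _ : Fin (n + 1) => ℝ) 0).symm fun x y => ?_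
    ext i
    refine Fin.cases ?_ (fun j => ?_) i <;> simp [MeasurableEquiv.piFinSuccAbove]

/-- The Prékopa–Leindler inequality on Euclidean space, by induction on the dimension. -/
theorem prekopaLeindler_euclideanSpace {t s : ℝ} (ht : 0 < t) (hs : 0 < s) (hts : t + s = 1)
    (n : ℕ) : PrekopaLeindler (volume : Measure (EuclideanSpace ℝ (Fin n))) t s :=
  (prekopaLeindler_pi ht hs hts n).of_measurePreserving _
    (PiLp.volume_preserving_toLp (Fin n)) fun x y => by
      ext i
      simp

/-! ### The entropy inequality for exponentials of regular functions -/

theorem ofReal_integral_le_lintegral_ofReal {α : Type*} [MeasurableSpace α] {μ : Measure α}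
    {f : α → ℝ} (hf : Integrable f μ) :
    ENNReal.ofReal (∫ x, f x ∂μ) ≤ ∫⁻ x, ENNReal.ofReal (f x) ∂μ := by
  calc ENNReal.ofReal (∫ x, f x ∂μ) ≤ ENNReal.ofReal (∫ x, max (f x) 0 ∂μ) :=
        ENNReal.ofReal_le_ofReal (integral_mono hf hf.pos_part fun x => le_max_left _ _)
    _ = ∫⁻ x, ENNReal.ofReal (max (f x) 0) ∂μ :=
        ofReal_integral_eq_lintegral_ofReal hf.pos_part (.of_forall fun x => le_max_right _ _)
    _ = _ := by simp [ENNReal.ofReal_max]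

/-- The measure on Euclidean space with Lebesgue density `exp (-W)`. -/
noncomputable def gibbs {k : ℕ} (W : EuclideanSpace ℝ (Fin k) → ℝ) :
    Measure (EuclideanSpace ℝ (Fin k)) :=
  volume.withDensity fun x => ENNReal.ofReal (Real.exp (-W x))

/-- The Prékopa–Leindler inequality for the triple `exp (a - W)`, `exp (-W)`, `exp (b - W)`. The
strong convexity of `W` leaves room for the quadratic term in the hypothesis. -/
theorem rpow_lintegral_exp_le_of_strongConvexOn {k : ℕ} {W : EuclideanSpace ℝ (Fin k) → ℝ}
    (hWm : Measurable W) (hW : StrongConvexOn Set.univ 1 W) [IsProbabilityMeasure (gibbs W)]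
    {t s : ℝ} (ht : 0 < t) (hs : 0 < s) (hts : t + s = 1) {a b : EuclideanSpace ℝ (Fin k) → ℝ}
    (ha : Measurable a) (hb : Measurable b)
    (h : ∀ x y, t * a x ≤ t * s / 2 * ‖x - y‖ ^ 2 + b (t • x + s • y)) :
    (∫⁻ x, ENNReal.ofReal (Real.exp (a x)) ∂gibbs W) ^ t
      ≤ ∫⁻ x, ENNReal.ofReal (Real.exp (b x)) ∂gibbs W := by
  have hd : Measurable fun x => ENNReal.ofReal (Real.exp (-W x)) := by fun_prop
  have hint : ∀ f : EuclideanSpace ℝ (Fin k) → ℝ, Measurable f →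
      ∫⁻ x, ENNReal.ofReal (Real.exp (f x)) ∂gibbs W
        = ∫⁻ x, ENNReal.ofReal (Real.exp (f x - W x)) := by
    intro f hf
    rw [gibbs, lintegral_withDensity_eq_lintegral_mul _ hd (by fun_prop)]
    refine lintegral_congr fun x => ?_
    simp only [Pi.mul_apply]
    rw [← ENNReal.ofReal_mul (Real.exp_pos _).le, ← Real.exp_add]
    ring_nf
  have h1 : ∫⁻ x, ENNReal.ofReal (Real.exp (-W x)) = 1 := by
    have := measure_univ (μ := gibbs W)
    rwa [gibbs, withDensity_apply _ MeasurableSet.univ, setLIntegral_univ] at this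
  have hpow : ∀ c r : ℝ, ENNReal.ofReal (Real.exp c) ^ r = ENNReal.ofReal (Real.exp (r * c)) := by
    intro c r
    rw [ENNReal.ofReal_rpow_of_pos (Real.exp_pos _), ← Real.exp_mul, mul_comm]
  have key := prekopaLeindler_euclideanSpace ht hs hts k
    (u := fun x => ENNReal.ofReal (Real.exp (a x - W x)))
    (v := fun x => ENNReal.ofReal (Real.exp (-W x)))
    (w := fun x => ENNReal.ofReal (Real.exp (b x - W x)))
    (by fun_prop) (by fun_prop) (by fun_prop) (fun x y => by
      rw [hpow, hpow, ← ENNReal.ofReal_mul (Real.exp_pos _).le, ← Real.exp_add]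
      refine ENNReal.ofReal_le_ofReal (Real.exp_le_exp.2 ?_)
      have hc := hW.2 (Set.mem_univ x) (Set.mem_univ y) ht.le hs.le hts
      have := h x y
      simp only [smul_eq_mul] at hc
      linarith)
  rwa [h1, ENNReal.one_rpow, mul_one, ← hint a ha, ← hint b hb] at key

/-- A bound for the Hopf–Lax regularisation of `g` at small times: the supremum over `h` of
`g (x + h) - ‖h‖² / (2τ)` is at most `g x + τ (‖g' x‖ + ε)² / 2`, where `τ = s / (1 - s)`. -/
theorem eventually_le_add_mul_sq_add_mul_sq {E : Type*} [NormedAddCommGroup E] [NormedSpace ℝ E]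
    {g : E → ℝ} (hg : Differentiable ℝ g) {C : ℝ} (hC : ∀ x, ‖fderiv ℝ g x‖ ≤ C)
    (huc : UniformContinuous (fderiv ℝ g)) {ε : ℝ} (hε : 0 < ε) :
    ∀ᶠ s in nhdsWithin (0 : ℝ) (Set.Ioi 0), ∀ x h, g (x + h) ≤
      g x + s / (2 * (1 - s)) * (‖fderiv ℝ g x‖ + ε) ^ 2 + (1 - s) / (2 * s) * ‖h‖ ^ 2 := by
  obtain ⟨δ, hδ, hδε⟩ := Metric.uniformContinuous_iff.1 huc ε hε
  have hC0 : 0 ≤ C := (norm_nonneg _).trans (hC 0)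
  have hs1 : ∀ᶠ s in nhdsWithin (0 : ℝ) (Set.Ioi 0), s < 1 / 2 :=
    nhdsWithin_le_nhds (Iio_mem_nhds (by norm_num))
  have hs2 : ∀ᶠ s in nhdsWithin (0 : ℝ) (Set.Ioi 0), s < δ / (4 * (C + 1)) :=
    nhdsWithin_le_nhds (Iio_mem_nhds (by positivity))
  filter_upwards [self_mem_nhdsWithin, hs1, hs2] with s hs0 hs1 hs2 x h
  have hs0 : 0 < s := hs0
  have ht : 0 < 1 - s := by linarith
  rw [lt_div_iff₀ (by positivity)] at hs2
  by_cases hh : ‖h‖ < δ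
  · have hmv : g (x + h) - g x ≤ (‖fderiv ℝ g x‖ + ε) * ‖h‖ := by
      have := Convex.norm_image_sub_le_of_norm_fderiv_le (𝕜 := ℝ) (f := g)
        (C := ‖fderiv ℝ g x‖ + ε) (s := Metric.ball x δ) (x := x) (y := x + h)
        (fun z _ => hg z) (fun z hz => by
          have h1 := hδε (a := z) (b := x) (by simpa using hz)
          rw [dist_eq_norm] at h1
          calc ‖fderiv ℝ g z‖ = ‖fderiv ℝ g x + (fderiv ℝ g z - fderiv ℝ g x)‖ := by simp
            _ ≤ _ := norm_add_le _ _
            _ ≤ _ := by linarith) (convex_ball x δ) (by simp [hδ]) (by simp [hh])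
      rw [add_sub_cancel_left] at this
      exact (le_abs_self _).trans this
    set a := ‖fderiv ℝ g x‖ + ε
    have hsq : a * ‖h‖ ≤ s / (2 * (1 - s)) * a ^ 2 + (1 - s) / (2 * s) * ‖h‖ ^ 2 := by
      have : s / (2 * (1 - s)) * a ^ 2 + (1 - s) / (2 * s) * ‖h‖ ^ 2 - a * ‖h‖
          = (s * a - (1 - s) * ‖h‖) ^ 2 / (2 * (1 - s) * s) := by
        field_simp
        ring
      have h0 : 0 ≤ (s * a - (1 - s) * ‖h‖) ^ 2 / (2 * (1 - s) * s) := by positivity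
      linarith
    linarith
  · have hmv : g (x + h) - g x ≤ C * ‖h‖ := by
      have := Convex.norm_image_sub_le_of_norm_fderiv_le (𝕜 := ℝ) (f := g)
        (C := C) (s := Set.univ) (x := x) (y := x + h)
        (fun z _ => hg z) (fun z _ => hC z) convex_univ trivial trivial
      rw [add_sub_cancel_left] at this
      exact (le_abs_self _).trans this
    have h1 : C * ‖h‖ ≤ (1 - s) / (2 * s) * ‖h‖ ^ 2 := by
      have : C ≤ (1 - s) / (2 * s) * ‖h‖ := by
        rw [div_mul_eq_mul_div, le_div_iff₀ (by positivity)]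
        nlinarith
      nlinarith [norm_nonneg h]
    have h0 : 0 ≤ s / (2 * (1 - s)) * (‖fderiv ℝ g x‖ + ε) ^ 2 := by positivity
    linarith

/-- The logarithmic Sobolev inequality for `exp g`: the first-order term, as `s → 0`, of the
Prékopa–Leindler inequality with weights `1 - s` and `s` applied to `exp (g / (1 - s) - W)` and
`exp (-W)`. -/
theorem integral_mul_exp_le_of_strongConvexOn {k : ℕ} {W : EuclideanSpace ℝ (Fin k) → ℝ}
    (hWm : Measurable W) (hW : StrongConvexOn Set.univ 1 W) [IsProbabilityMeasure (gibbs W)]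
    {g : EuclideanSpace ℝ (Fin k) → ℝ} (hg : ContDiff ℝ 1 g) {M : ℝ} (hM : ∀ x, |g x| ≤ M)
    {C : ℝ} (hC : ∀ x, ‖fderiv ℝ g x‖ ≤ C) (huc : UniformContinuous (fderiv ℝ g))
    (h1 : ∫ x, Real.exp (g x) ∂gibbs W = 1) :
    ∫ x, g x * Real.exp (g x) ∂gibbs W
      ≤ 1 / 2 * ∫ x, ‖fderiv ℝ g x‖ ^ 2 * Real.exp (g x) ∂gibbs W := by
  set μ := gibbs W
  have hgc : Continuous g := hg.continuous
  have hg'c : Continuous (fderiv ℝ g) := hg.continuous_fderiv (by norm_num)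
  have hC0 : 0 ≤ C := (norm_nonneg _).trans (hC 0)
  have hexpM : ∀ x, Real.exp (g x) ≤ Real.exp M := fun x =>
    Real.exp_le_exp.2 ((le_abs_self _).trans (hM x))
  have hI : ∀ f : EuclideanSpace ℝ (Fin k) → ℝ, Continuous f → ∀ B, (∀ x, |f x| ≤ B) →
      Integrable (fun x => f x * Real.exp (g x)) μ := by
    intro f hf B hB
    refine .of_bound (by fun_prop) (B * Real.exp M) (.of_forall fun x => ?_)
    rw [norm_mul, Real.norm_eq_abs, Real.norm_eq_abs, Real.abs_exp]
    exact mul_le_mul (hB x) (hexpM x) (Real.exp_pos _).le ((abs_nonneg _).trans (hB x))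
  have hIexp : Integrable (fun x => Real.exp (g x)) μ := by
    simpa using hI (fun _ => 1) continuous_const 1 (by simp)
  have hIg := hI g hgc M hM
  have hI1 := hI (fun x => ‖fderiv ℝ g x‖) (by fun_prop) C (by simpa using hC)
  have hI2 := hI (fun x => ‖fderiv ℝ g x‖ ^ 2) (by fun_prop) (C ^ 2) (fun x => by
    rw [abs_of_nonneg (by positivity)]
    exact pow_le_pow_left₀ (norm_nonneg _) (hC x) 2)
  set m := ∫ x, g x * Real.exp (g x) ∂μ with hm
  set D := ∫ x, ‖fderiv ℝ g x‖ ^ 2 * Real.exp (g x) ∂μ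
  have hstep : ∀ ε > 0, m ≤ 1 / 2 * ∫ x, (‖fderiv ℝ g x‖ + ε) ^ 2 * Real.exp (g x) ∂μ := by
    intro ε hε
    set Q := ∫ x, (‖fderiv ℝ g x‖ + ε) ^ 2 * Real.exp (g x) ∂μ
    set A := C + ε
    have hA : 0 < A := by positivity
    have hAx : ∀ x, (‖fderiv ℝ g x‖ + ε) ^ 2 ≤ A ^ 2 := fun x =>
      pow_le_pow_left₀ (by positivity) (by have := hC x; simp only [A]; linarith) 2
    have hIQ := hI (fun x => (‖fderiv ℝ g x‖ + ε) ^ 2) (by fun_prop) (A ^ 2) (fun x => by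
      rw [abs_of_nonneg (by positivity)]
      exact hAx x)
    have hs1 : ∀ᶠ s in nhdsWithin (0 : ℝ) (Set.Ioi 0), s < 1 / 2 :=
      nhdsWithin_le_nhds (Iio_mem_nhds (by norm_num))
    have hs2 : ∀ᶠ s in nhdsWithin (0 : ℝ) (Set.Ioi 0), s < 1 / A ^ 2 :=
      nhdsWithin_le_nhds (Iio_mem_nhds (by positivity))
    have hev : ∀ᶠ s in nhdsWithin (0 : ℝ) (Set.Ioi 0), m ≤ 1 / (2 * (1 - s)) * Q + s * A ^ 4 := by
      filter_upwards [self_mem_nhdsWithin, hs1, hs2,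
        eventually_le_add_mul_sq_add_mul_sq (hg.differentiable (by norm_num)) hC huc hε]
        with s hs0 hs1 hs2 hHL
      have hs0 : 0 < s := hs0
      have ht : 0 < 1 - s := by linarith
      rw [lt_div_iff₀ (by positivity)] at hs2
      have hPL := rpow_lintegral_exp_le_of_strongConvexOn hWm hW ht hs0 (by ring)
        (a := fun x => g x / (1 - s))
        (b := fun x => g x + s / (2 * (1 - s)) * (‖fderiv ℝ g x‖ + ε) ^ 2)
        (by fun_prop) (by fun_prop) (fun x y => by
          have := hHL ((1 - s) • x + s • y) (s • (x - y))
          rw [show (1 - s) • x + s • y + s • (x - y) = x by module, norm_smul, mul_pow,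
            Real.norm_eq_abs, sq_abs] at this
          have e1 : (1 - s) * (g x / (1 - s)) = g x := by field_simp
          have e2 : (1 - s) / (2 * s) * (s ^ 2 * ‖x - y‖ ^ 2) = (1 - s) * s / 2 * ‖x - y‖ ^ 2 := by
            field_simp
          rw [e1]
          rw [e2] at this
          linarith)
      -- Jensen's inequality for the probability measure `exp g • μ`.
      have hlow : ENNReal.ofReal (Real.exp (s / (1 - s) * m))
          ≤ ∫⁻ x, ENNReal.ofReal (Real.exp (g x / (1 - s))) ∂μ := by
        have hint : ∫ x, Real.exp (s / (1 - s) * m) * (1 + s / (1 - s) * (g x - m)) *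
            Real.exp (g x) ∂μ = Real.exp (s / (1 - s) * m) := by
          have : ∀ x, Real.exp (s / (1 - s) * m) * (1 + s / (1 - s) * (g x - m)) * Real.exp (g x)
              = Real.exp (s / (1 - s) * m) * ((1 - s / (1 - s) * m) * Real.exp (g x)
                + s / (1 - s) * (g x * Real.exp (g x))) := fun x => by ring
          simp_rw [this]
          rw [integral_const_mul, integral_add (hIexp.const_mul _) (hIg.const_mul _),
            integral_const_mul, integral_const_mul, h1, ← hm]
          ring
        rw [← hint]
        have hInt : Integrable (fun x => Real.exp (s / (1 - s) * m) *
            (1 + s / (1 - s) * (g x - m)) * Real.exp (g x)) μ := by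
          have := ((hIexp.const_mul (1 - s / (1 - s) * m)).add
            (hIg.const_mul (s / (1 - s)))).const_mul (Real.exp (s / (1 - s) * m))
          refine this.congr (.of_forall fun x => ?_)
          simp only [Pi.add_apply]
          ring
        refine (ofReal_integral_le_lintegral_ofReal hInt).trans
          (lintegral_mono fun x => ENNReal.ofReal_le_ofReal ?_)
        have e : g x / (1 - s) = s / (1 - s) * m + s / (1 - s) * (g x - m) + g x := by
          field_simp
          ring
        rw [e, Real.exp_add, Real.exp_add]
        gcongr
        linarith [Real.add_one_le_exp (s / (1 - s) * (g x - m))]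
      have hup : ∫⁻ x, ENNReal.ofReal
          (Real.exp (g x + s / (2 * (1 - s)) * (‖fderiv ℝ g x‖ + ε) ^ 2)) ∂μ
          ≤ ENNReal.ofReal (1 + s / (2 * (1 - s)) * Q + s ^ 2 * A ^ 4) := by
        have hIsum : Integrable (fun x => Real.exp (g x) + s / (2 * (1 - s)) *
            ((‖fderiv ℝ g x‖ + ε) ^ 2 * Real.exp (g x))) μ := hIexp.add (hIQ.const_mul _)
        have hint : ∫ x, (Real.exp (g x) + s / (2 * (1 - s)) *
            ((‖fderiv ℝ g x‖ + ε) ^ 2 * Real.exp (g x)) + s ^ 2 * A ^ 4 * Real.exp (g x)) ∂μ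
            = 1 + s / (2 * (1 - s)) * Q + s ^ 2 * A ^ 4 := by
          rw [integral_add hIsum (hIexp.const_mul _),
            integral_add hIexp (hIQ.const_mul _), integral_const_mul, integral_const_mul, h1]
          ring
        rw [← hint, ofReal_integral_eq_lintegral_ofReal
          (f := fun x => Real.exp (g x) + s / (2 * (1 - s)) *
            ((‖fderiv ℝ g x‖ + ε) ^ 2 * Real.exp (g x)) + s ^ 2 * A ^ 4 * Real.exp (g x))
          (hIsum.add (hIexp.const_mul _))
          (.of_forall fun x => by simp only [Pi.zero_apply]; positivity)]
        refine lintegral_mono fun x => ENNReal.ofReal_le_ofReal ?_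
        set c := s / (2 * (1 - s)) * (‖fderiv ℝ g x‖ + ε) ^ 2
        have hc0 : 0 ≤ c := by positivity
        have hcs : c ≤ s * A ^ 2 := by
          have h2 : s / (2 * (1 - s)) ≤ s := div_le_self hs0.le (by linarith)
          exact mul_le_mul h2 (hAx x) (by positivity) hs0.le
        have hc1 : |c| ≤ 1 := by rw [abs_of_nonneg hc0]; linarith
        have hexp := (abs_le.1 (Real.abs_exp_sub_one_sub_id_le hc1)).2
        have hc2 : c ^ 2 ≤ s ^ 2 * A ^ 4 := by
          calc c ^ 2 ≤ (s * A ^ 2) ^ 2 := pow_le_pow_left₀ hc0 hcs 2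
            _ = s ^ 2 * A ^ 4 := by ring
        have h3 : Real.exp c ≤ 1 + c + s ^ 2 * A ^ 4 := by linarith
        rw [Real.exp_add]
        calc Real.exp (g x) * Real.exp c ≤ Real.exp (g x) * (1 + c + s ^ 2 * A ^ 4) := by gcongr
          _ = _ := by simp only [c]; ring
      have hchain : ENNReal.ofReal (Real.exp (s * m))
          ≤ ENNReal.ofReal (1 + s / (2 * (1 - s)) * Q + s ^ 2 * A ^ 4) := by
        calc ENNReal.ofReal (Real.exp (s * m))
            = ENNReal.ofReal (Real.exp (s / (1 - s) * m)) ^ (1 - s) := by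
              rw [ENNReal.ofReal_rpow_of_pos (Real.exp_pos _), ← Real.exp_mul]
              congr 2
              field_simp
          _ ≤ _ := ENNReal.rpow_le_rpow hlow ht.le
          _ ≤ _ := hPL
          _ ≤ _ := hup
      have hQ0 : 0 ≤ Q := integral_nonneg fun x => by positivity
      rw [ENNReal.ofReal_le_ofReal_iff (by positivity)] at hchain
      have h4 : s * m ≤ s * (1 / (2 * (1 - s)) * Q + s * A ^ 4) := by
        have := Real.add_one_le_exp (s * m)
        have e : s * (1 / (2 * (1 - s)) * Q + s * A ^ 4)
            = s / (2 * (1 - s)) * Q + s ^ 2 * A ^ 4 := by ring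
        linarith
      exact le_of_mul_le_mul_left h4 hs0
    have hlim : Filter.Tendsto (fun s : ℝ => 1 / (2 * (1 - s)) * Q + s * A ^ 4)
        (nhdsWithin 0 (Set.Ioi 0)) (nhds (1 / (2 * (1 - 0)) * Q + 0 * A ^ 4)) := by
      refine Filter.Tendsto.mono_left ?_ nhdsWithin_le_nhds
      refine ContinuousAt.tendsto (f := fun s : ℝ => 1 / (2 * (1 - s)) * Q + s * A ^ 4) ?_
      fun_prop (disch := norm_num)
    have := ge_of_tendsto hlim hev
    simpa using this
  have hstep2 : ∀ᶠ ε in nhdsWithin (0 : ℝ) (Set.Ioi 0),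
      m ≤ 1 / 2 * (D + 2 * ε * (∫ x, ‖fderiv ℝ g x‖ * Real.exp (g x) ∂μ) + ε ^ 2) := by
    filter_upwards [self_mem_nhdsWithin] with ε hε
    refine (hstep ε hε).trans_eq ?_
    have : ∀ x, (‖fderiv ℝ g x‖ + ε) ^ 2 * Real.exp (g x) = ‖fderiv ℝ g x‖ ^ 2 * Real.exp (g x)
        + 2 * ε * (‖fderiv ℝ g x‖ * Real.exp (g x)) + ε ^ 2 * Real.exp (g x) := fun x => by ring
    simp_rw [this]
    have hIsum : Integrable (fun x => ‖fderiv ℝ g x‖ ^ 2 * Real.exp (g x)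
        + 2 * ε * (‖fderiv ℝ g x‖ * Real.exp (g x))) μ := hI2.add (hI1.const_mul _)
    rw [integral_add hIsum (hIexp.const_mul _),
      integral_add hI2 (hI1.const_mul _), integral_const_mul, integral_const_mul, h1, mul_one]
  have hlim : Filter.Tendsto
      (fun ε : ℝ => 1 / 2 * (D + 2 * ε * (∫ x, ‖fderiv ℝ g x‖ * Real.exp (g x) ∂μ) + ε ^ 2))
      (nhdsWithin 0 (Set.Ioi 0))
      (nhds (1 / 2 * (D + 2 * 0 * (∫ x, ‖fderiv ℝ g x‖ * Real.exp (g x) ∂μ) + 0 ^ 2))) := by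
    refine Filter.Tendsto.mono_left (Continuous.tendsto ?_ 0) nhdsWithin_le_nhds
    fun_prop
  simpa using ge_of_tendsto hlim hstep2

/-! ### The entropy integrand -/

/-- The integrand `a log (a / m) - a + m` of the relative entropy: for `a ≥ 0` and `m > 0` it is
nonnegative, and it differs from `a log (a / m)` by a term that integrates to zero when `m` is a
(conditional) mean of `a`. Since `a / 0 = 0`, its value at `m = 0` is `-a`, which is meaningful only
for `a = 0`; this case is treated separately below. -/
noncomputable def entDensity (a m : ℝ) : ℝ := a * Real.log (a / m) - a + m

/-- Young's inequality for the Legendre pair `x log x - x + 1` and `exp ψ - 1`. -/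
theorem mul_le_entDensity_add {a m : ℝ} (ha : 0 ≤ a) (hm : 0 < m) (ψ : ℝ) :
    a * ψ ≤ entDensity a m + m * (Real.exp ψ - 1) := by
  unfold entDensity
  rcases ha.eq_or_lt with rfl | ha
  · have := Real.exp_pos ψ
    simp only [zero_mul, zero_div, sub_zero, zero_add]
    nlinarith
  · have h1 := Real.add_one_le_exp (ψ - Real.log (a / m))
    rw [Real.exp_sub, Real.exp_log (by positivity), div_div_eq_mul_div, le_div_iff₀ ha] at h1
    linarith

theorem entDensity_nonneg {a m : ℝ} (ha : 0 ≤ a) (hm : 0 < m) : 0 ≤ entDensity a m := by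
  simpa using mul_le_entDensity_add ha hm 0

theorem measurable_entDensity : Measurable (Function.uncurry entDensity) := by
  unfold entDensity Function.uncurry
  fun_prop

theorem entDensity_eq {a m : ℝ} (hm : m ≠ 0) :
    entDensity a m = a * Real.log a - a * Real.log m - a + m := by
  unfold entDensity
  rcases eq_or_ne a 0 with rfl | ha
  · simp
  · rw [Real.log_div ha hm]
    ring

theorem Filter.Tendsto.entDensity {ι : Type*} {l : Filter ι} {a m : ι → ℝ} {a₀ m₀ : ℝ}
    (ha : Filter.Tendsto a l (nhds a₀)) (hm : Filter.Tendsto m l (nhds m₀)) (hm₀ : m₀ ≠ 0) :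
    Filter.Tendsto (fun i => entDensity (a i) (m i)) l (nhds (entDensity a₀ m₀)) := by
  rw [entDensity_eq hm₀]
  have hev : ∀ᶠ i in l, m i ≠ 0 := hm.eventually_ne hm₀
  refine Filter.Tendsto.congr' (hev.mono fun i hi => (entDensity_eq hi).symm) ?_
  exact ((((Real.continuous_mul_log.tendsto a₀).comp ha).sub
    (ha.mul (hm.log hm₀))).sub ha).add hm

/-! ### The logarithmic Sobolev inequality for strongly log-concave measures -/

/-- The case of `exp g = (δ + f²) / Z`: since `g' = 2 f f' / (δ + f²)`, the right-hand side of the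
entropy inequality for `exp g` is at most `2 ∫ ‖f'‖²`. The positive `δ` keeps `g` bounded. -/
theorem integral_entDensity_le_of_hasCompactSupport {k : ℕ} {W : EuclideanSpace ℝ (Fin k) → ℝ}
    (hWm : Measurable W) (hW : StrongConvexOn Set.univ 1 W) [IsProbabilityMeasure (gibbs W)]
    {f : EuclideanSpace ℝ (Fin k) → ℝ} (hf : ContDiff ℝ 1 f) (hfs : HasCompactSupport f)
    {δ : ℝ} (hδ : 0 < δ) :
    0 < ∫ x, (δ + f x ^ 2) ∂gibbs W ∧
    Integrable (fun x => δ + f x ^ 2) (gibbs W) ∧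
    Integrable (fun x => entDensity (δ + f x ^ 2) (∫ y, (δ + f y ^ 2) ∂gibbs W)) (gibbs W) ∧
    ∫ x, entDensity (δ + f x ^ 2) (∫ y, (δ + f y ^ 2) ∂gibbs W) ∂gibbs W
      ≤ 2 * ∫ x, ‖fderiv ℝ f x‖ ^ 2 ∂gibbs W := by
  set μ := gibbs W
  have hfc : Continuous f := hf.continuous
  have hf'c : Continuous (fderiv ℝ f) := hf.continuous_fderiv (by norm_num)
  obtain ⟨B, hB⟩ := hfs.exists_bound_of_continuous hfc
  obtain ⟨B', hB'⟩ := (hfs.fderiv ℝ).exists_bound_of_continuous hf'c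
  have hB0 : 0 ≤ B := (norm_nonneg _).trans (hB 0)
  have hF0 : ∀ x, 0 < δ + f x ^ 2 := fun x => by positivity
  have hFB : ∀ x, δ + f x ^ 2 ≤ δ + B ^ 2 := fun x => by
    have := sq_le_sq' (abs_le.1 (hB x)).1 (abs_le.1 (hB x)).2
    linarith
  have hFI : Integrable (fun x => δ + f x ^ 2) μ :=
    .of_bound (by fun_prop) (δ + B ^ 2) (.of_forall fun x => by
      rw [Real.norm_eq_abs, abs_of_pos (hF0 x)]
      exact hFB x)
  set Z := ∫ x, (δ + f x ^ 2) ∂μ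
  have hZ : 0 < Z := by
    calc 0 < δ := hδ
      _ = ∫ _, δ ∂μ := by simp
      _ ≤ Z := integral_mono (integrable_const _) hFI fun x => by
        have := sq_nonneg (f x)
        simp only
        linarith
  set g : EuclideanSpace ℝ (Fin k) → ℝ := fun x => Real.log (δ + f x ^ 2) - Real.log Z with hgdef
  have hg : ContDiff ℝ 1 g :=
    ((contDiff_const.add (hf.pow 2)).log fun x => (hF0 x).ne').sub contDiff_const
  have hgexp : ∀ x, Real.exp (g x) = (δ + f x ^ 2) / Z := fun x => by
    rw [hgdef, Real.exp_sub, Real.exp_log (hF0 x), Real.exp_log hZ]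
  have hglog : ∀ x, g x = Real.log ((δ + f x ^ 2) / Z) := fun x => by
    rw [Real.log_div (hF0 x).ne' hZ.ne']
  have hg' : fderiv ℝ g = (fun x => 2 * f x / (δ + f x ^ 2)) • fderiv ℝ f := by
    ext1 x
    rw [Pi.smul_apply']
    have h1 := (hf.differentiable (by norm_num) x).hasFDerivAt
    have h2 := (((h1.pow 2).const_add δ).log (hF0 x).ne').sub_const (Real.log Z)
    rw [h2.fderiv, smul_smul]
    congr 1
    simp
    ring
  have hM : ∀ x, |g x| ≤ max |Real.log δ| |Real.log (δ + B ^ 2)| + |Real.log Z| := fun x => by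
    refine (abs_sub _ _).trans (add_le_add_left ?_ _)
    refine abs_le_max_abs_abs (Real.log_le_log hδ ?_) (Real.log_le_log (hF0 x) (hFB x))
    have := sq_nonneg (f x)
    linarith
  have hg'c : Continuous (fderiv ℝ g) := hg.continuous_fderiv (by norm_num)
  have hg's : HasCompactSupport (fderiv ℝ g) := by
    rw [hg']
    exact (hfs.fderiv ℝ).smul_left
  obtain ⟨C, hC⟩ := hg's.exists_bound_of_continuous hg'c
  have hexp1 : ∫ x, Real.exp (g x) ∂μ = 1 := by
    simp_rw [hgexp]
    rw [integral_div, div_self hZ.ne']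
  have key := integral_mul_exp_le_of_strongConvexOn hWm hW hg hM hC
    (hg's.uniformContinuous_of_continuous hg'c) hexp1
  have hlogI : Integrable (fun x => (δ + f x ^ 2) * Real.log ((δ + f x ^ 2) / Z)) μ := by
    simp_rw [← hglog]
    have hgc : Continuous g := hg.continuous
    refine hFI.mul_bdd (c := max |Real.log δ| |Real.log (δ + B ^ 2)| + |Real.log Z|)
      (by fun_prop) (.of_forall hM)
  have hDI : Integrable (fun x => ‖fderiv ℝ f x‖ ^ 2) μ :=
    .of_bound (by fun_prop) (B' ^ 2) (.of_forall fun x => by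
      rw [Real.norm_eq_abs, abs_of_nonneg (by positivity)]
      exact pow_le_pow_left₀ (norm_nonneg _) (hB' x) 2)
  have hEI : Integrable (fun x => entDensity (δ + f x ^ 2) Z) μ :=
    (hlogI.sub hFI).add (integrable_const Z)
  refine ⟨hZ, hFI, hEI, ?_⟩
  have e1 : ∫ x, entDensity (δ + f x ^ 2) Z ∂μ
      = Z * ∫ x, g x * Real.exp (g x) ∂μ := by
    have hsub : Integrable (fun x => (δ + f x ^ 2) * Real.log ((δ + f x ^ 2) / Z)
        - (δ + f x ^ 2)) μ := hlogI.sub hFI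
    unfold entDensity
    rw [integral_add hsub (integrable_const _), integral_sub hlogI hFI, ← integral_const_mul]
    simp only [integral_const, probReal_univ, one_smul]
    have : ∀ x, (δ + f x ^ 2) * Real.log ((δ + f x ^ 2) / Z) = Z * (g x * Real.exp (g x)) :=
      fun x => by
        rw [hgexp, ← hglog]
        field_simp
    simp_rw [this]
    simp only [Z]
    ring
  have e2 : Z * (1 / 2 * ∫ x, ‖fderiv ℝ g x‖ ^ 2 * Real.exp (g x) ∂μ)
      ≤ 2 * ∫ x, ‖fderiv ℝ f x‖ ^ 2 ∂μ := by
    rw [← integral_const_mul, ← integral_const_mul, ← integral_const_mul]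
    refine integral_mono_of_nonneg (.of_forall fun x => ?_) (hDI.const_mul 2)
      (.of_forall fun x => ?_)
    · simp only [Pi.zero_apply]
      positivity
    · have hx := hF0 x
      simp only [hg', Pi.smul_apply', hgexp, norm_smul, mul_pow, Real.norm_eq_abs, sq_abs]
      have : Z * (1 / 2 * ((2 * f x / (δ + f x ^ 2)) ^ 2 * ‖fderiv ℝ f x‖ ^ 2
          * ((δ + f x ^ 2) / Z))) = 2 * ‖fderiv ℝ f x‖ ^ 2 * (f x ^ 2 / (δ + f x ^ 2)) := by
        field_simp
      rw [this]
      refine mul_le_of_le_one_right (by positivity) ((div_le_one hx).2 (by linarith))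
  calc _ = _ := e1
    _ ≤ _ := mul_le_mul_of_nonneg_left key hZ.le
    _ ≤ _ := e2

/-- Compactly supported approximations `f n`, with `|f n| ≤ |f|`, of a differentiable function,
whose derivatives exceed that of `f` by at most `b / (n + 1)`. -/
theorem exists_hasCompactSupport_approx {E : Type*} [NormedAddCommGroup E]
    [InnerProductSpace ℝ E] [FiniteDimensional ℝ E] {f : E → ℝ} (hf : ContDiff ℝ 1 f) :
    ∃ (F : ℕ → E → ℝ) (b : ℝ), 0 ≤ b ∧ (∀ n, ContDiff ℝ 1 (F n)) ∧
      (∀ n, HasCompactSupport (F n)) ∧ (∀ n x, |F n x| ≤ |f x|) ∧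
      (∀ x, Filter.Tendsto (fun n => F n x) Filter.atTop (nhds (f x))) ∧
      ∀ n x, ‖fderiv ℝ (F n) x‖ ≤ ‖fderiv ℝ f x‖ + b / (n + 1) := by
  let χ : ContDiffBump (0 : E) := ⟨1, 2, one_pos, one_lt_two⟩
  have hχ : ContDiff ℝ 1 (χ : E → ℝ) := χ.contDiff
  obtain ⟨b, hb⟩ := (χ.hasCompactSupport.fderiv ℝ).exists_bound_of_continuous
    (hχ.continuous_fderiv (by norm_num))
  have hb0 : 0 ≤ b := (norm_nonneg _).trans (hb 0)
  -- `f / (1 + (f / N)²)` is bounded by `N`; the cutoff at radius `N²` has slope at most `b / N²`.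
  let N : ℕ → ℝ := fun n => n + 1
  have hN : ∀ n, 0 < N n := fun n => by positivity
  let T : ℕ → E → ℝ := fun n x => f x / (1 + (f x / N n) ^ 2)
  let R : ℕ → E → ℝ := fun n x => χ ((N n ^ 2)⁻¹ • x)
  have hTd : ∀ n, ContDiff ℝ 1 (T n) := fun n =>
    hf.div (contDiff_const.add ((hf.div_const _).pow 2)) fun x => by positivity
  have hRd : ∀ n, ContDiff ℝ 1 (R n) := fun n => hχ.comp (contDiff_const_smul _)
  have hTf : ∀ n x, |T n x| ≤ |f x| := fun n x => by
    simp only [T, abs_div]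
    refine div_le_self (abs_nonneg _) ?_
    rw [abs_of_pos (by positivity)]
    have := sq_nonneg (f x / N n)
    linarith
  have hTN : ∀ n x, |T n x| ≤ N n := fun n x => by
    simp only [T, abs_div]
    rw [abs_of_pos (a := 1 + (f x / N n) ^ 2) (by positivity), div_le_iff₀ (by positivity)]
    have h1 : |f x| = N n * |f x / N n| := by
      rw [abs_div, abs_of_pos (hN n)]
      field_simp [(hN n).ne']
    rw [h1, ← sq_abs]
    refine mul_le_mul_of_nonneg_left ?_ (hN n).le
    nlinarith [sq_nonneg (|f x / N n| - 1)]
  have hR0 : ∀ n x, 0 ≤ R n x := fun n x => χ.nonneg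
  have hR1 : ∀ n x, R n x ≤ 1 := fun n x => χ.le_one
  have hder : ∀ c : ℝ, 0 < c → ∀ y, HasDerivAt (fun y : ℝ => y / (1 + (y / c) ^ 2))
      ((1 - (y / c) ^ 2) / (1 + (y / c) ^ 2) ^ 2) y := fun c hc y => by
    have := (hasDerivAt_id y).div ((((hasDerivAt_id y).div_const c).pow 2).const_add 1)
      (show 1 + (y / c) ^ 2 ≠ 0 by positivity)
    refine this.congr_deriv ?_
    simp only [id, Pi.pow_apply]
    congr 1
    have := hc.ne'
    norm_num
    field_simp
    ring
  have hT' : ∀ n x, ‖fderiv ℝ (T n) x‖ ≤ ‖fderiv ℝ f x‖ := fun n x => by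
    have h1 := (hf.differentiable (by norm_num) x).hasFDerivAt
    have h3 : HasFDerivAt (T n) _ x := (hder _ (hN n) (f x)).comp_hasFDerivAt x h1
    rw [h3.fderiv, norm_smul]
    refine mul_le_of_le_one_left (norm_nonneg _) ?_
    rw [Real.norm_eq_abs, abs_div, div_le_one (by positivity), abs_of_pos (a := (_ : ℝ) ^ 2)
      (by positivity), abs_le]
    have := sq_nonneg (f x / N n)
    constructor <;> nlinarith
  have hR' : ∀ n x, ‖fderiv ℝ (R n) x‖ ≤ b / N n ^ 2 := fun n x => by
    have h1 : HasFDerivAt (fun y : E => (N n ^ 2)⁻¹ • y)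
        ((N n ^ 2)⁻¹ • ContinuousLinearMap.id ℝ E) x := (hasFDerivAt_id x).const_smul _
    have h2 : HasFDerivAt (R n) _ x :=
      (hχ.differentiable (by norm_num) ((N n ^ 2)⁻¹ • x)).hasFDerivAt.comp x h1
    rw [h2.fderiv, ContinuousLinearMap.comp_smul, ContinuousLinearMap.comp_id, norm_smul,
      Real.norm_eq_abs, abs_of_pos (by have := hN n; positivity), inv_mul_eq_div]
    have := hN n
    gcongr
    exact hb _
  refine ⟨fun n x => R n x * T n x, b, hb0, fun n => (hRd n).mul (hTd n), fun n => ?_,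
    fun n x => ?_, fun x => ?_, fun n x => ?_⟩
  · have h1 : HasCompactSupport (R n) :=
      χ.hasCompactSupport.comp_homeomorph (Homeomorph.smulOfNeZero _ (by
        have := hN n
        positivity))
    exact h1.mul_right
  · rw [abs_mul, abs_of_nonneg (hR0 n x)]
    exact (mul_le_of_le_one_left (abs_nonneg _) (hR1 n x)).trans (hTf n x)
  · have hNt : Filter.Tendsto N Filter.atTop Filter.atTop :=
      Filter.tendsto_atTop_add_const_right _ _ tendsto_natCast_atTop_atTop
    have h1 : Filter.Tendsto (fun n => T n x) Filter.atTop (nhds (f x)) := by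
      have : Filter.Tendsto (fun n => T n x) Filter.atTop (nhds (f x / (1 + 0 ^ 2))) :=
        tendsto_const_nhds.div (tendsto_const_nhds.add ((hNt.const_div_atTop (f x)).pow 2))
          (by norm_num)
      simpa using this
    have h2 : Filter.Tendsto (fun n => R n x) Filter.atTop (nhds 1) := by
      have h3 : Filter.Tendsto (fun n => (N n ^ 2)⁻¹ • x) Filter.atTop (nhds ((0 : ℝ) • x)) :=
        (((Filter.tendsto_pow_atTop two_ne_zero).comp hNt).inv_tendsto_atTop).smul_const x
      rw [zero_smul] at h3
      have h4 := (hχ.continuous.tendsto 0).comp h3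
      rwa [χ.one_of_mem_closedBall (by simp [χ])] at h4
    simpa using h2.mul h1
  · have hTx := ((hTd n).differentiable (by norm_num) x).hasFDerivAt
    have hRx := ((hRd n).differentiable (by norm_num) x).hasFDerivAt
    have := (hRx.mul hTx).fderiv
    change ‖fderiv ℝ (R n * T n) x‖ ≤ _
    rw [this]
    refine (norm_add_le _ _).trans ?_
    rw [norm_smul, norm_smul, Real.norm_eq_abs, Real.norm_eq_abs, abs_of_nonneg (hR0 n x)]
    refine add_le_add ?_ ?_
    · exact (mul_le_of_le_one_left (norm_nonneg _) (hR1 n x)).trans (hT' n x)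
    · calc |T n x| * ‖fderiv ℝ (R n) x‖ ≤ N n * (b / N n ^ 2) :=
            mul_le_mul (hTN n x) (hR' n x) (norm_nonneg _) (hN n).le
        _ = b / N n := by
          have := (hN n).ne'
          field_simp

theorem exists_isCompact_measureReal_compl_le {E : Type*} [NormedAddCommGroup E]
    [InnerProductSpace ℝ E] [FiniteDimensional ℝ E] [MeasurableSpace E] [BorelSpace E]
    (μ : Measure E) [IsFiniteMeasure μ] {ε : ℝ} (hε : 0 < ε) :
    ∃ K, IsCompact K ∧ μ.real Kᶜ ≤ ε := by
  have : ProperSpace E := FiniteDimensional.proper_real E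
  obtain ⟨K, -, hK, hμK⟩ := (MeasurableSet.univ (α := E)).exists_isCompact_lt_add
    (measure_ne_top μ _) (ε := ENNReal.ofReal ε) (by simpa using hε)
  refine ⟨K, hK, ?_⟩
  have h1 : μ.real Set.univ ≤ μ.real K + ε := by
    rw [measureReal_def, measureReal_def]
    have := ENNReal.toReal_mono (by finiteness) hμK.le
    rwa [ENNReal.toReal_add (by finiteness) (by finiteness), ENNReal.toReal_ofReal hε.le] at this
  rw [measureReal_compl hK.measurableSet]
  linarith

/-- A second-moment bound from an entropy bound: if `F ≤ c` on a set `K` with nearly full measure,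
Young's inequality with `ψ = 2` controls the integral of `F` over the complement of `K`. -/
theorem integral_le_of_integral_entDensity_le {α : Type*} [MeasurableSpace α] {μ : Measure α}
    [IsProbabilityMeasure μ] {F : α → ℝ} (hF0 : ∀ x, 0 ≤ F x) (hFI : Integrable F μ)
    (hZ : 0 < ∫ x, F x ∂μ) (hEI : Integrable (fun x => entDensity (F x) (∫ y, F y ∂μ)) μ) {r : ℝ}
    (hE : ∫ x, entDensity (F x) (∫ y, F y ∂μ) ∂μ ≤ r) {K : Set α} (hKm : MeasurableSet K)
    (hμK : μ.real Kᶜ ≤ (Real.exp 2 - 1)⁻¹) {c : ℝ} (hc : 0 ≤ c) (hFc : ∀ x ∈ K, F x ≤ c) :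
    ∫ x, F x ∂μ ≤ 2 * c + r := by
  set Z := ∫ x, F x ∂μ
  have hexp2 : 0 < Real.exp 2 - 1 := by
    have := Real.add_one_le_exp 2
    linarith
  have h1 : ∫ x in K, F x ∂μ ≤ c := by
    calc ∫ x in K, F x ∂μ ≤ ∫ x in K, c ∂μ :=
          setIntegral_mono_on hFI.integrableOn (integrable_const _) hKm hFc
      _ = μ.real K * c := by simp
      _ ≤ c := mul_le_of_le_one_left hc measureReal_le_one
  have h2 : ∫ x in Kᶜ, F x * 2 ∂μ ≤ r + Z := by
    have hcI : Integrable (fun _ => Z * (Real.exp 2 - 1)) (μ.restrict Kᶜ) := integrable_const _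
    calc ∫ x in Kᶜ, F x * 2 ∂μ
        ≤ ∫ x in Kᶜ, (entDensity (F x) Z + Z * (Real.exp 2 - 1)) ∂μ :=
          setIntegral_mono_on (hFI.mul_const 2).integrableOn (hEI.integrableOn.add hcI)
            hKm.compl fun x _ => mul_le_entDensity_add (hF0 x) hZ 2
      _ = ∫ x in Kᶜ, entDensity (F x) Z ∂μ + μ.real Kᶜ * (Z * (Real.exp 2 - 1)) := by
          rw [integral_add hEI.integrableOn hcI]
          simp
      _ ≤ r + Z := by
          refine add_le_add ((setIntegral_le_integral hEI (.of_forall fun x =>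
            entDensity_nonneg (hF0 x) hZ)).trans hE) ?_
          calc μ.real Kᶜ * (Z * (Real.exp 2 - 1))
              ≤ (Real.exp 2 - 1)⁻¹ * (Z * (Real.exp 2 - 1)) :=
                mul_le_mul_of_nonneg_right hμK (mul_nonneg hZ.le hexp2.le)
            _ = Z := by field_simp
  rw [integral_mul_const] at h2
  have h3 : ∫ x in K, F x ∂μ + ∫ x in Kᶜ, F x ∂μ = Z := integral_add_compl hKm hFI
  linarith

/-- Approximations `F n → f²`, dominated by `1 + f²`, whose entropies are bounded by quantities
converging to `2 ∫ ‖f'‖²`. -/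
theorem exists_approx_integral_entDensity_le {k : ℕ} {W : EuclideanSpace ℝ (Fin k) → ℝ}
    (hWm : Measurable W) (hW : StrongConvexOn Set.univ 1 W) [IsProbabilityMeasure (gibbs W)]
    {f : EuclideanSpace ℝ (Fin k) → ℝ} (hf : ContDiff ℝ 1 f)
    (hD : Integrable (fun x => ‖fderiv ℝ f x‖ ^ 2) (gibbs W)) :
    ∃ (F : ℕ → EuclideanSpace ℝ (Fin k) → ℝ) (r : ℕ → ℝ), (∀ n, Continuous (F n)) ∧
      (∀ n x, 0 < F n x) ∧ (∀ n x, F n x ≤ 1 + f x ^ 2) ∧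
      (∀ x, Filter.Tendsto (fun n => F n x) Filter.atTop (nhds (f x ^ 2))) ∧
      Filter.Tendsto r Filter.atTop (nhds (2 * ∫ x, ‖fderiv ℝ f x‖ ^ 2 ∂gibbs W)) ∧
      ∀ n, 0 < ∫ x, F n x ∂gibbs W ∧ Integrable (F n) (gibbs W) ∧
        Integrable (fun x => entDensity (F n x) (∫ y, F n y ∂gibbs W)) (gibbs W) ∧
        ∫ x, entDensity (F n x) (∫ y, F n y ∂gibbs W) ∂gibbs W ≤ r n := by
  set μ := gibbs W
  set D := ∫ x, ‖fderiv ℝ f x‖ ^ 2 ∂μ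
  obtain ⟨φ, b, hb0, hφd, hφs, hφf, hφt, hφ'⟩ := exists_hasCompactSupport_approx hf
  have hφc : ∀ n, Continuous (φ n) := fun n => (hφd n).continuous
  have hδ : ∀ n : ℕ, (0 : ℝ) < 1 / (n + 1) := fun n => by positivity
  have hδ1 : ∀ n : ℕ, (1 : ℝ) / (n + 1) ≤ 1 := fun n => by
    rw [div_le_one (by positivity)]
    linarith [n.cast_nonneg (α := ℝ)]
  have hδt : Filter.Tendsto (fun n : ℕ => (1 : ℝ) / (n + 1)) Filter.atTop (nhds 0) :=
    tendsto_one_div_add_atTop_nhds_zero_nat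
  set F : ℕ → EuclideanSpace ℝ (Fin k) → ℝ := fun n x => 1 / (n + 1) + φ n x ^ 2 with hFdef
  have hFc : ∀ n, Continuous (F n) := fun n => by
    have := hφc n
    fun_prop
  have hF0 : ∀ n x, 0 < F n x := fun n x => by
    have := hδ n
    positivity
  have hFf : ∀ n x, F n x ≤ 1 + f x ^ 2 := fun n x => add_le_add (hδ1 n) (sq_le_sq.2 (hφf n x))
  have hFt : ∀ x, Filter.Tendsto (fun n => F n x) Filter.atTop (nhds (f x ^ 2)) := fun x => by
    simpa [hFdef] using hδt.add ((hφt x).pow 2)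
  set r : ℕ → ℝ := fun n => 2 * ((1 + 1 / (n + 1)) * D + 2 * b ^ 2 * (1 / (n + 1))) with hrdef
  have hE : ∀ n, 2 * ∫ x, ‖fderiv ℝ (φ n) x‖ ^ 2 ∂μ ≤ r n := fun n => by
    refine mul_le_mul_of_nonneg_left ?_ zero_le_two
    have hI : Integrable (fun x => (1 + 1 / ((n : ℝ) + 1)) * ‖fderiv ℝ f x‖ ^ 2 +
        2 * b ^ 2 * (1 / ((n : ℝ) + 1))) μ := (hD.const_mul _).add (integrable_const _)
    calc ∫ x, ‖fderiv ℝ (φ n) x‖ ^ 2 ∂μ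
        ≤ ∫ x, ((1 + 1 / ((n : ℝ) + 1)) * ‖fderiv ℝ f x‖ ^ 2 +
          2 * b ^ 2 * (1 / ((n : ℝ) + 1))) ∂μ := by
          refine integral_mono_of_nonneg (.of_forall fun x => sq_nonneg _) hI
            (.of_forall fun x => ?_)
          refine (pow_le_pow_left₀ (norm_nonneg _) (hφ' n x) 2).trans ?_
          set a := ‖fderiv ℝ f x‖
          set e : ℝ := 1 / (n + 1) with he
          have e0 : 0 < e := hδ n
          have e1 : e ≤ 1 := hδ1 n
          have hbe : b / (n + 1) = b * e := by rw [he]; ring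
          rw [hbe]
          -- `2ab ≤ a² + b²`, with both sides multiplied by `e`.
          have h1 : 0 ≤ e * (a - b) ^ 2 := by positivity
          have h2 : 0 ≤ e * (1 - e) * b ^ 2 :=
            mul_nonneg (mul_nonneg e0.le (by linarith)) (sq_nonneg b)
          simp only
          nlinarith
      _ = _ := by
        rw [integral_add (hD.const_mul _) (integrable_const _), integral_const_mul]
        simp [D]
  have hrt : Filter.Tendsto r Filter.atTop (nhds (2 * D)) := by
    have := (((hδt.const_add 1).mul_const D).add (hδt.const_mul (2 * b ^ 2))).const_mul 2
    simpa [hrdef] using this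
  refine ⟨F, r, hFc, hF0, hFf, hFt, hrt, fun n => ?_⟩
  obtain ⟨h1, h2, h3, h4⟩ :=
    integral_entDensity_le_of_hasCompactSupport hWm hW (hφd n) (hφs n) (hδ n)
  exact ⟨h1, h2, h3, h4.trans (hE n)⟩

/-- The logarithmic Sobolev inequality in normalised form. The inequality for the compactly
supported approximations of `f` bounds their second moments, by Young's inequality on the
complement of a large compact set, and passes to the limit by Fatou's lemma. -/
theorem integrable_sq_and_lintegral_entDensity_le_of_isProbabilityMeasure {k : ℕ}
    {W : EuclideanSpace ℝ (Fin k) → ℝ}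
    (hWm : Measurable W) (hW : StrongConvexOn Set.univ 1 W) [IsProbabilityMeasure (gibbs W)]
    {f : EuclideanSpace ℝ (Fin k) → ℝ} (hf : ContDiff ℝ 1 f)
    (hD : Integrable (fun x => ‖fderiv ℝ f x‖ ^ 2) (gibbs W)) :
    Integrable (fun x => f x ^ 2) (gibbs W) ∧
    ∫⁻ x, ENNReal.ofReal (entDensity (f x ^ 2) (∫ y, f y ^ 2 ∂gibbs W)) ∂gibbs W
      ≤ ENNReal.ofReal (2 * ∫ x, ‖fderiv ℝ f x‖ ^ 2 ∂gibbs W) := by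
  set μ := gibbs W
  set D := ∫ x, ‖fderiv ℝ f x‖ ^ 2 ∂μ
  have hfc : Continuous f := hf.continuous
  obtain ⟨F, r, hFc, hF0, hFf, hFt, hrt, hn⟩ := exists_approx_integral_entDensity_le hWm hW hf hD
  set Z : ℕ → ℝ := fun n => ∫ x, F n x ∂μ
  have hZ : ∀ n, 0 < Z n := fun n => (hn n).1
  have hFI : ∀ n, Integrable (F n) μ := fun n => (hn n).2.1
  have hEI : ∀ n, Integrable (fun x => entDensity (F n x) (Z n)) μ := fun n => (hn n).2.2.1
  have hE : ∀ n, ∫ x, entDensity (F n x) (Z n) ∂μ ≤ r n := fun n => (hn n).2.2.2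
  obtain ⟨R, hR⟩ := hrt.bddAbove_range
  have hexp2 : 0 < Real.exp 2 - 1 := by
    have := Real.add_one_le_exp 2
    linarith
  obtain ⟨K, hK, hμK⟩ := exists_isCompact_measureReal_compl_le μ
    (ε := (Real.exp 2 - 1)⁻¹) (by positivity)
  obtain ⟨B, hB⟩ := hK.exists_bound_of_continuousOn hfc.continuousOn
  have hZb : ∀ n, Z n ≤ 2 * (1 + B ^ 2) + R := fun n =>
    integral_le_of_integral_entDensity_le (fun x => (hF0 n x).le) (hFI n) (hZ n) (hEI n)
      ((hE n).trans (hR ⟨n, rfl⟩)) hK.measurableSet hμK (by positivity) fun x hx => by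
        have := sq_le_sq' (abs_le.1 (hB x hx)).1 (abs_le.1 (hB x hx)).2
        linarith [hFf n x]
  have hf2 : Integrable (fun x => f x ^ 2) μ := by
    refine (lintegral_ofReal_ne_top_iff_integrable (by fun_prop)
      (.of_forall fun x => sq_nonneg _)).1 ?_
    refine ne_top_of_le_ne_top (b := ENNReal.ofReal (2 * (1 + B ^ 2) + R))
      ENNReal.ofReal_ne_top ?_
    calc ∫⁻ x, ENNReal.ofReal (f x ^ 2) ∂μ
        = ∫⁻ x, Filter.liminf (fun n => ENNReal.ofReal (F n x)) Filter.atTop ∂μ :=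
          lintegral_congr fun x => (ENNReal.tendsto_ofReal (hFt x)).liminf_eq.symm
      _ ≤ Filter.liminf (fun n => ∫⁻ x, ENNReal.ofReal (F n x) ∂μ) Filter.atTop :=
          lintegral_liminf_le fun n => (hFc n).measurable.ennreal_ofReal
      _ ≤ _ := by
          refine Filter.liminf_le_of_le (by isBoundedDefault) fun c hc => ?_
          obtain ⟨n, hn⟩ := hc.exists
          refine hn.trans ?_
          rw [← ofReal_integral_eq_lintegral_ofReal (hFI n) (.of_forall fun x => (hF0 n x).le)]
          exact ENNReal.ofReal_le_ofReal (hZb n)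
  refine ⟨hf2, ?_⟩
  set z := ∫ y, f y ^ 2 ∂μ
  have hdom : Integrable (fun x => 1 + f x ^ 2) μ := (integrable_const (1 : ℝ)).add hf2
  have hZt : Filter.Tendsto Z Filter.atTop (nhds z) := by
    refine tendsto_integral_of_dominated_convergence (fun x => 1 + f x ^ 2)
      (fun n => (hFI n).aestronglyMeasurable) hdom
      (fun n => .of_forall fun x => ?_) (.of_forall hFt)
    rw [Real.norm_eq_abs, abs_of_pos (hF0 n x)]
    exact hFf n x
  by_cases hz0 : z = 0
  · have h0 : (fun x => f x ^ 2) =ᵐ[μ] 0 :=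
      (integral_eq_zero_iff_of_nonneg (fun x => sq_nonneg _) hf2).1 hz0
    have : ∫⁻ x, ENNReal.ofReal (entDensity (f x ^ 2) z) ∂μ = ∫⁻ x, 0 ∂μ := by
      refine lintegral_congr_ae ?_
      filter_upwards [h0] with x hx
      simp only [Pi.zero_apply] at hx
      simp [hx, hz0, entDensity]
    rw [this]
    simp
  · have hEt : ∀ x, Filter.Tendsto (fun n => entDensity (F n x) (Z n)) Filter.atTop
        (nhds (entDensity (f x ^ 2) z)) := fun x => Filter.Tendsto.entDensity (hFt x) hZt hz0
    have hEm : ∀ n, Measurable fun x => ENNReal.ofReal (entDensity (F n x) (Z n)) := fun n => by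
      have h1 : Measurable fun x => (F n x, Z n) := (hFc n).measurable.prodMk measurable_const
      exact (measurable_entDensity.comp h1).ennreal_ofReal
    calc ∫⁻ x, ENNReal.ofReal (entDensity (f x ^ 2) z) ∂μ
        = ∫⁻ x, Filter.liminf (fun n => ENNReal.ofReal (entDensity (F n x) (Z n)))
            Filter.atTop ∂μ :=
          lintegral_congr fun x => (ENNReal.tendsto_ofReal (hEt x)).liminf_eq.symm
      _ ≤ Filter.liminf (fun n => ∫⁻ x, ENNReal.ofReal (entDensity (F n x) (Z n)) ∂μ)
            Filter.atTop := lintegral_liminf_le hEm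
      _ ≤ Filter.liminf (fun n => ENNReal.ofReal (r n)) Filter.atTop := by
          refine Filter.liminf_le_liminf (.of_forall fun n => ?_)
          rw [← ofReal_integral_eq_lintegral_ofReal (hEI n)
            (.of_forall fun x => entDensity_nonneg (hF0 n x).le (hZ n))]
          exact ENNReal.ofReal_le_ofReal (hE n)
      _ = ENNReal.ofReal (2 * D) := (ENNReal.tendsto_ofReal hrt).liminf_eq

/-- The logarithmic Sobolev inequality for a finite measure with density `exp (-W)`, where `W` is
`1`-strongly convex; the mean of `f ^ 2` is written as a quotient of Lebesgue integrals. -/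
theorem integrable_sq_and_lintegral_entDensity_le {k : ℕ} {W : EuclideanSpace ℝ (Fin k) → ℝ}
    (hWm : Measurable W) (hW : StrongConvexOn Set.univ 1 W) (hfin : gibbs W Set.univ ≠ ⊤)
    {f : EuclideanSpace ℝ (Fin k) → ℝ} (hf : ContDiff ℝ 1 f)
    (hD : ∫⁻ x, ENNReal.ofReal (‖fderiv ℝ f x‖ ^ 2) ∂gibbs W ≠ ⊤) :
    Integrable (fun x => f x ^ 2) (gibbs W) ∧
    ∫⁻ x, ENNReal.ofReal (entDensity (f x ^ 2)
        ((∫⁻ y, ENNReal.ofReal (f y ^ 2) ∂gibbs W) / gibbs W Set.univ).toReal) ∂gibbs W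
      ≤ 2 * ∫⁻ x, ENNReal.ofReal (‖fderiv ℝ f x‖ ^ 2) ∂gibbs W := by
  have hdm : Measurable fun x => ENNReal.ofReal (Real.exp (-W x)) := by fun_prop
  have hfc : Continuous f := hf.continuous
  have hf'c : Continuous (fderiv ℝ f) := hf.continuous_fderiv (by norm_num)
  set c := gibbs W Set.univ with hc
  have hc0 : c ≠ 0 := by
    rw [hc, Ne, Measure.measure_univ_eq_zero, gibbs, withDensity_eq_zero_iff hdm.aemeasurable]
    intro h0
    obtain ⟨x, hx⟩ := h0.exists
    simp only [Pi.zero_apply, ENNReal.ofReal_eq_zero] at hx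
    exact absurd (Real.exp_pos (-W x)) (not_lt.2 hx)
  have hcr : 0 < c.toReal := ENNReal.toReal_pos hc0 hfin
  have hc' : c⁻¹ ≠ ⊤ := ENNReal.inv_ne_top.2 hc0
  have hc'0 : c⁻¹ ≠ 0 := ENNReal.inv_ne_zero.2 hfin
  -- Adding a constant to `W` normalises the measure.
  have hgibbs : gibbs (fun x => W x + Real.log c.toReal) = c⁻¹ • gibbs W := by
    rw [gibbs, gibbs, ← withDensity_smul _ hdm]
    congr 1
    ext x
    rw [Pi.smul_apply, smul_eq_mul, neg_add, Real.exp_add, Real.exp_neg (Real.log _),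
      Real.exp_log hcr, ENNReal.ofReal_mul (Real.exp_pos _).le, ENNReal.ofReal_inv_of_pos hcr,
      ENNReal.ofReal_toReal hfin, mul_comm]
  have hW' : StrongConvexOn Set.univ 1 (fun x => W x + Real.log c.toReal) := by
    refine ⟨convex_univ, fun x hx y hy a b ha hb hab => ?_⟩
    have := hW.2 hx hy ha hb hab
    simp only [smul_eq_mul] at this ⊢
    have e : Real.log c.toReal = a * Real.log c.toReal + b * Real.log c.toReal := by
      rw [← add_mul, hab, one_mul]
    linarith
  have hprob : IsProbabilityMeasure (gibbs (fun x => W x + Real.log c.toReal)) := by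
    rw [hgibbs]
    exact ⟨by rw [Measure.smul_apply, smul_eq_mul, ← hc, ENNReal.inv_mul_cancel hc0 hfin]⟩
  have hDI : Integrable (fun x => ‖fderiv ℝ f x‖ ^ 2) (gibbs W) :=
    (lintegral_ofReal_ne_top_iff_integrable (by fun_prop) (.of_forall fun x => sq_nonneg _)).1 hD
  obtain ⟨h1, h2⟩ := integrable_sq_and_lintegral_entDensity_le_of_isProbabilityMeasure
    (W := fun x => W x + Real.log c.toReal) (by fun_prop) hW' hf
    (by rw [hgibbs]; exact hDI.smul_measure hc')
  have hmean : ∫ y, f y ^ 2 ∂gibbs (fun x => W x + Real.log c.toReal)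
      = ((∫⁻ y, ENNReal.ofReal (f y ^ 2) ∂gibbs W) / c).toReal := by
    rw [hgibbs, integral_eq_lintegral_of_nonneg_ae (.of_forall fun x => sq_nonneg _)
      (by fun_prop), lintegral_smul_measure, smul_eq_mul, mul_comm, ENNReal.div_eq_inv_mul,
      mul_comm]
  rw [hmean, hgibbs, integral_smul_measure, lintegral_smul_measure] at h2
  rw [hgibbs] at h1
  refine ⟨(integrable_smul_measure hc'0 hc').1 h1, ?_⟩
  rw [smul_eq_mul, smul_eq_mul, mul_left_comm, ENNReal.ofReal_mul ENNReal.toReal_nonneg,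
    ENNReal.ofReal_toReal hc', ENNReal.mul_le_mul_iff_right hc'0 hc',
    ENNReal.ofReal_mul zero_le_two, ofReal_integral_eq_lintegral_ofReal hDI
      (.of_forall fun x => sq_nonneg _)] at h2
  simpa using h2

/-! ### The variational characterisation of the conditional entropy -/

section Conditional

variable {Ω : Type*} {m m₀ : MeasurableSpace Ω} {μ : Measure[m₀] Ω} {F : Ω → ℝ}

/-- A nonnegative function and its conditional expectation vanish almost everywhere on the same
`m`-measurable sets, having the same integral over them. -/
theorem ae_eq_zero_iff_condExp_ae_eq_zero [IsProbabilityMeasure μ] (hm : m ≤ m₀)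
    (hF0 : 0 ≤ᵐ[μ] F) (hFI : Integrable F μ) {s : Set Ω} (hs : MeasurableSet[m] s) :
    (∀ᵐ x ∂μ, x ∈ s → F x = 0) ↔ ∀ᵐ x ∂μ, x ∈ s → (μ[F | m]) x = 0 := by
  have hM0 : 0 ≤ᵐ[μ] μ[F | m] := condExp_nonneg hF0
  have h1 := setIntegral_eq_zero_iff_of_nonneg_ae (s := s) (ae_restrict_of_ae hF0) hFI.integrableOn
  have h2 := setIntegral_eq_zero_iff_of_nonneg_ae (s := s) (ae_restrict_of_ae hM0)
    integrable_condExp.integrableOn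
  rw [setIntegral_condExp hm hFI hs, h1] at h2
  rw [Filter.EventuallyEq, Filter.EventuallyEq, ae_restrict_iff' (hm s hs),
    ae_restrict_iff' (hm s hs)] at h2
  exact h2

/-- On an `m`-measurable set on which `G` and the conditional expectation of `F` are bounded and
bounded away from zero, the difference of the two integrals is the integral of
`entDensity (μ[F | m]) G ≥ 0`. -/
theorem setLIntegral_entDensity_condExp_le [IsProbabilityMeasure μ] (hm : m ≤ m₀)
    (hF0 : ∀ x, 0 ≤ F x) (hFm : Measurable[m₀] F) (hFI : Integrable F μ) {G : Ω → ℝ}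
    (hG : Measurable[m] G) {s : Set Ω} (hs : MeasurableSet[m] s) {a b : ℝ} (ha : 0 < a)
    (hGs : ∀ x ∈ s, G x ∈ Set.Icc a b) (hMs : ∀ x ∈ s, (μ[F | m]) x ∈ Set.Icc a b) :
    ∫⁻ x in s, ENNReal.ofReal (entDensity (F x) ((μ[F | m]) x)) ∂μ
      ≤ ∫⁻ x in s, ENNReal.ofReal (entDensity (F x) (G x)) ∂μ := by
  set M := μ[F | m]
  have hMm : Measurable[m] M := stronglyMeasurable_condExp.measurable
  have hMI : Integrable M μ := integrable_condExp
  have hs0 : MeasurableSet[m₀] s := hm s hs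
  have hGm : Measurable[m₀] G := hG.mono hm le_rfl
  have hMm' : Measurable[m₀] M := hMm.mono hm le_rfl
  have hentF : ∀ {H : Ω → ℝ}, Measurable[m₀] H →
      Measurable[m₀] fun x => entDensity (F x) (H x) := fun hH =>
    measurable_entDensity.comp (hFm.prodMk hH)
  by_cases htop : ∫⁻ x in s, ENNReal.ofReal (entDensity (F x) (G x)) ∂μ = ⊤
  · rw [htop]
    exact le_top
  have hGpos : ∀ x ∈ s, 0 < G x := fun x hx => ha.trans_le (hGs x hx).1
  have hMpos : ∀ x ∈ s, 0 < M x := fun x hx => ha.trans_le (hMs x hx).1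
  have hGnn : 0 ≤ᵐ[μ.restrict s] fun x => entDensity (F x) (G x) :=
    (ae_restrict_iff' hs0).2 (.of_forall fun x hx => entDensity_nonneg (hF0 x) (hGpos x hx))
  have hMnn : 0 ≤ᵐ[μ.restrict s] fun x => entDensity (F x) (M x) :=
    (ae_restrict_iff' hs0).2 (.of_forall fun x hx => entDensity_nonneg (hF0 x) (hMpos x hx))
  have hGint : IntegrableOn (fun x => entDensity (F x) (G x)) s μ :=
    (lintegral_ofReal_ne_top_iff_integrable (hentF hGm).aestronglyMeasurable hGnn).1 htop
  have hGI : IntegrableOn G s μ :=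
    .of_bound (measure_lt_top _ _) hGm.aestronglyMeasurable (max |a| |b|)
      ((ae_restrict_iff' hs0).2 (.of_forall fun x hx =>
        abs_le_max_abs_abs (hGs x hx).1 (hGs x hx).2))
  -- Pulling the bounded `m`-measurable factor `log (M / G)` out of the conditional expectation.
  set ℓ : Ω → ℝ := s.indicator fun x => Real.log (M x) - Real.log (G x) with hℓ
  have hℓm : StronglyMeasurable[m] ℓ :=
    (((Real.measurable_log.comp hMm).sub (Real.measurable_log.comp hG)).indicator
      hs).stronglyMeasurable
  have hℓb : ∀ x, ‖ℓ x‖ ≤ 2 * max |Real.log a| |Real.log b| := fun x => by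
    by_cases hx : x ∈ s
    · have hb1 : ∀ y ∈ Set.Icc a b, |Real.log y| ≤ max |Real.log a| |Real.log b| := fun y hy =>
        abs_le_max_abs_abs (Real.log_le_log ha hy.1) (Real.log_le_log (ha.trans_le hy.1) hy.2)
      simp only [hℓ, Set.indicator_of_mem hx, Real.norm_eq_abs]
      have h1 := hb1 _ (hMs x hx)
      have h2 := hb1 _ (hGs x hx)
      have h3 := abs_sub (Real.log (M x)) (Real.log (G x))
      linarith
    · simp only [hℓ, Set.indicator_of_notMem hx, norm_zero]
      positivity
  have hℓm' : AEStronglyMeasurable ℓ μ := (hℓm.mono hm).aestronglyMeasurable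
  have hℓF : Integrable (fun x => ℓ x * F x) μ := hFI.bdd_mul hℓm' (.of_forall hℓb)
  have hℓM : Integrable (fun x => ℓ x * M x) μ := hMI.bdd_mul hℓm' (.of_forall hℓb)
  have hpull : ∫ x in s, ℓ x * F x ∂μ = ∫ x in s, ℓ x * M x ∂μ := by
    rw [← setIntegral_condExp hm hℓF hs]
    refine integral_congr_ae (ae_restrict_of_ae ?_)
    exact condExp_stronglyMeasurable_mul_of_bound hm hℓm hFI _ (.of_forall hℓb)
  have hident : ∀ x ∈ s, entDensity (F x) (M x)
      = entDensity (F x) (G x) - (ℓ x * F x + G x - M x) := fun x hx => by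
    rw [entDensity_eq (hGpos x hx).ne', entDensity_eq (hMpos x hx).ne', hℓ,
      Set.indicator_of_mem hx]
    ring
  have hident2 : ∀ x ∈ s, ℓ x * M x + G x - M x = entDensity (M x) (G x) := fun x hx => by
    rw [entDensity_eq (hGpos x hx).ne', hℓ, Set.indicator_of_mem hx]
    ring
  have hsub1 : IntegrableOn (fun x => ℓ x * F x + G x) s μ := hℓF.integrableOn.add hGI
  have hsub2 : IntegrableOn (fun x => ℓ x * M x + G x) s μ := hℓM.integrableOn.add hGI
  have hsub : IntegrableOn (fun x => ℓ x * F x + G x - M x) s μ := hsub1.sub hMI.integrableOn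
  have hMint : IntegrableOn (fun x => entDensity (F x) (M x)) s μ :=
    (hGint.sub hsub).congr_fun (fun x hx => (hident x hx).symm) hs0
  have hgap : 0 ≤ ∫ x in s, (ℓ x * F x + G x - M x) ∂μ := by
    have e : ∫ x in s, (ℓ x * F x + G x - M x) ∂μ = ∫ x in s, (ℓ x * M x + G x - M x) ∂μ := by
      rw [integral_sub hsub1 hMI.integrableOn, integral_sub hsub2 hMI.integrableOn,
        integral_add hℓF.integrableOn hGI, integral_add hℓM.integrableOn hGI, hpull]
    rw [e]
    refine setIntegral_nonneg hs0 fun x hx => ?_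
    rw [hident2 x hx]
    exact entDensity_nonneg (hMpos x hx).le (hGpos x hx)
  rw [← ofReal_integral_eq_lintegral_ofReal hMint hMnn,
    ← ofReal_integral_eq_lintegral_ofReal hGint hGnn]
  refine ENNReal.ofReal_le_ofReal ?_
  rw [setIntegral_congr_fun hs0 hident, integral_sub hGint hsub]
  linarith

/-- Among all `m`-measurable functions, the conditional expectation of `F` minimises the relative
entropy `G ↦ ∫ F log (F / G) - F + G`. The sets on which `G` and `μ[F | m]` lie in `[1 / n, n]`
exhaust the set where both are positive; elsewhere `F` and `μ[F | m]` vanish. -/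
theorem lintegral_entDensity_condExp_le [IsProbabilityMeasure μ] (hm : m ≤ m₀)
    (hF0 : ∀ x, 0 ≤ F x) (hFm : Measurable[m₀] F) (hFI : Integrable F μ) {G : Ω → ℝ}
    (hG : Measurable[m] G) (hG0 : ∀ x, 0 ≤ G x) (hGF : ∀ᵐ x ∂μ, G x = 0 → F x = 0) :
    ∫⁻ x, ENNReal.ofReal (entDensity (F x) ((μ[F | m]) x)) ∂μ
      ≤ ∫⁻ x, ENNReal.ofReal (entDensity (F x) (G x)) ∂μ := by
  set M := μ[F | m]
  have hMm : Measurable[m] M := stronglyMeasurable_condExp.measurable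
  have hF0' : 0 ≤ᵐ[μ] F := .of_forall hF0
  have hM0 : 0 ≤ᵐ[μ] M := condExp_nonneg hF0'
  have hMF : ∀ᵐ x ∂μ, M x = 0 → F x = 0 :=
    (ae_eq_zero_iff_condExp_ae_eq_zero hm hF0' hFI (s := M ⁻¹' {0})
      (hMm (measurableSet_singleton 0))).2 (.of_forall fun x hx => hx)
  have hGM : ∀ᵐ x ∂μ, G x = 0 → M x = 0 :=
    (ae_eq_zero_iff_condExp_ae_eq_zero hm hF0' hFI (s := G ⁻¹' {0})
      (hG (measurableSet_singleton 0))).1 hGF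
  let I : ℕ → Set ℝ := fun n => Set.Icc (1 / ((n : ℝ) + 1)) n
  let s : ℕ → Set Ω := fun n => M ⁻¹' I n ∩ G ⁻¹' I n
  have hImono : Monotone I := fun i j hij => by
    have h1 : (i : ℝ) ≤ j := by exact_mod_cast hij
    exact Set.Icc_subset_Icc (one_div_le_one_div_of_le (by positivity) (by linarith)) h1
  have hIpos : ∀ y : ℝ, 0 < y → ∀ᶠ n in Filter.atTop, y ∈ I n := fun y hy => by
    filter_upwards [(tendsto_one_div_add_atTop_nhds_zero_nat (𝕜 := ℝ)).eventually_le_const hy,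
      tendsto_natCast_atTop_atTop.eventually_ge_atTop y] with n h1 h2
    exact ⟨h1, h2⟩
  have hsm : ∀ n, MeasurableSet[m] (s n) := fun n =>
    (hMm measurableSet_Icc).inter (hG measurableSet_Icc)
  have hsmono : Monotone s := fun i j hij =>
    Set.inter_subset_inter (Set.preimage_mono (hImono hij)) (Set.preimage_mono (hImono hij))
  have hUm : MeasurableSet[m₀] (⋃ n, s n) := .iUnion fun n => hm _ (hsm n)
  have hout : ∀ᵐ x ∂μ, x ∈ (⋃ n, s n)ᶜ → ENNReal.ofReal (entDensity (F x) (M x)) = 0 := by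
    filter_upwards [hM0, hMF, hGM] with x hx0 hxF hxM hx
    have hMx : M x = 0 := by
      by_contra hne
      have hGne : G x ≠ 0 := fun h => hne (hxM h)
      have hMp : 0 < M x := lt_of_le_of_ne hx0 (Ne.symm hne)
      have hGp : 0 < G x := lt_of_le_of_ne (hG0 x) (Ne.symm hGne)
      obtain ⟨n, h1, h2⟩ := ((hIpos _ hMp).and (hIpos _ hGp)).exists
      exact hx (Set.mem_iUnion.2 ⟨n, h1, h2⟩)
    simp [entDensity, hMx, hxF hMx]
  calc ∫⁻ x, ENNReal.ofReal (entDensity (F x) (M x)) ∂μ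
      = ∫⁻ x in ⋃ n, s n, ENNReal.ofReal (entDensity (F x) (M x)) ∂μ := by
        rw [← lintegral_add_compl _ hUm, setLIntegral_congr_fun_ae hUm.compl hout]
        simp
    _ = ⨆ n, ∫⁻ x in s n, ENNReal.ofReal (entDensity (F x) (M x)) ∂μ :=
        setLIntegral_iUnion_of_directed _ hsmono.directed_le
    _ ≤ ∫⁻ x, ENNReal.ofReal (entDensity (F x) (G x)) ∂μ := by
        refine iSup_le fun n => ?_
        refine (setLIntegral_entDensity_condExp_le hm hF0 hFm hFI hG (hsm n)
          (a := 1 / ((n : ℝ) + 1)) (b := n) (by positivity) (fun x hx => hx.2)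
          (fun x hx => hx.1)).trans ?_
        exact setLIntegral_le_lintegral _ _

end Conditional

/-! ### Quadratic forms of positive definite matrices -/

section QuadraticForm

variable {d : ℕ}

theorem continuous_sqNormWith (A : Matrix (Fin d) (Fin d) ℝ) : Continuous (sqNormWith A) := by
  unfold sqNormWith
  fun_prop

theorem sqNormWith_nonneg {A : Matrix (Fin d) (Fin d) ℝ} (hA : A.PosSemidef)
    (v : EuclideanSpace ℝ (Fin d)) : 0 ≤ sqNormWith A v := by
  exact hA.dotProduct_mulVec_nonneg v.ofLp

/-- The matrix `P` as a linear map, whose underlying function is `matrixMap P`. -/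
def matrixLinearMap (P : Matrix (Fin d) (Fin d) ℝ) :
    EuclideanSpace ℝ (Fin d) →ₗ[ℝ] EuclideanSpace ℝ (Fin d) where
  toFun := matrixMap P
  map_add' x y := by simp [matrixMap, Matrix.mulVec_add]
  map_smul' c x := by simp [matrixMap, Matrix.mulVec_smul]

theorem continuous_matrixMap (P : Matrix (Fin d) (Fin d) ℝ) : Continuous (matrixMap P) :=
  (matrixLinearMap P).continuous_of_finiteDimensional

theorem inner_matrixMap_transpose (P : Matrix (Fin d) (Fin d) ℝ) (u v : EuclideanSpace ℝ (Fin d)) :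
    inner ℝ (matrixMap Pᵀ u) v = inner ℝ u (matrixMap P v) := by
  simp only [EuclideanSpace.inner_eq_star_dotProduct, matrixMap, star_trivial,
    Matrix.mulVec_transpose]
  rw [dotProduct_comm, ← Matrix.dotProduct_mulVec, dotProduct_comm]

/-- The Cauchy–Schwarz inequality for the dual norms `‖·‖_{Γ⁻¹}` and `‖·‖_Γ`, from the
nonnegativity of the quadratic polynomial `λ ↦ ‖Γ⁻¹ u + λ v‖²_Γ`. -/
theorem inner_sq_le_sqNormWith_mul_sqNormWith {Γ : Matrix (Fin d) (Fin d) ℝ} (hΓ : Γ.PosDef)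
    (u v : EuclideanSpace ℝ (Fin d)) :
    inner ℝ u v ^ 2 ≤ sqNormWith Γ⁻¹ u * sqNormWith Γ v := by
  have hdet : IsUnit Γ.det := hΓ.det_pos.ne'.isUnit
  have hsym : Γᵀ = Γ := by simpa using hΓ.isHermitian.eq
  have hin : inner ℝ u v = u.ofLp ⬝ᵥ v.ofLp := by
    simp [EuclideanSpace.inner_eq_star_dotProduct, dotProduct_comm]
  have h : ∀ l : ℝ, 0 ≤ sqNormWith Γ v * (l * l) + 2 * inner ℝ u v * l + sqNormWith Γ⁻¹ u := by
    intro l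
    have h0 := sqNormWith_nonneg hΓ.posSemidef (WithLp.toLp 2 (Γ⁻¹ *ᵥ u.ofLp) + l • v)
    have e1 : Γ *ᵥ (Γ⁻¹ *ᵥ u.ofLp) = u.ofLp := by
      rw [Matrix.mulVec_mulVec, Matrix.mul_nonsing_inv _ hdet, Matrix.one_mulVec]
    have e2 : (Γ⁻¹ *ᵥ u.ofLp) ⬝ᵥ (Γ *ᵥ v.ofLp) = u.ofLp ⬝ᵥ v.ofLp := by
      rw [Matrix.dotProduct_mulVec, ← Matrix.mulVec_transpose, hsym, e1]
    simp only [sqNormWith, WithLp.ofLp_add, WithLp.ofLp_smul, Matrix.mulVec_add,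
      Matrix.mulVec_smul, e1, add_dotProduct, dotProduct_add, smul_dotProduct, dotProduct_smul,
      smul_eq_mul, e2] at h0
    rw [hin, sqNormWith, sqNormWith]
    have e3 : (Γ⁻¹ *ᵥ u.ofLp) ⬝ᵥ u.ofLp = u.ofLp ⬝ᵥ (Γ⁻¹ *ᵥ u.ofLp) := dotProduct_comm _ _
    have e4 : v.ofLp ⬝ᵥ u.ofLp = u.ofLp ⬝ᵥ v.ofLp := dotProduct_comm _ _
    rw [e3, e4] at h0
    linarith
  have := discrim_le_zero h
  rw [discrim] at this
  nlinarith

theorem exists_sqNormWith_le_mul_norm_sq (A : Matrix (Fin d) (Fin d) ℝ) :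
    ∃ C, 0 ≤ C ∧ ∀ v, sqNormWith A v ≤ C * ‖v‖ ^ 2 := by
  let L := (matrixLinearMap A).toContinuousLinearMap
  refine ⟨‖L‖, norm_nonneg _, fun v => ?_⟩
  calc sqNormWith A v = inner ℝ v (L v) := by
        change _ = inner ℝ v (matrixMap A v)
        simp [sqNormWith, EuclideanSpace.inner_eq_star_dotProduct, matrixMap, dotProduct_comm]
    _ ≤ ‖v‖ * ‖L v‖ := real_inner_le_norm _ _
    _ ≤ ‖v‖ * (‖L‖ * ‖v‖) := by gcongr; exact L.le_opNorm v
    _ = _ := by ring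

theorem exists_sqNormWith_inv_matrixMap_le {Γ : Matrix (Fin d) (Fin d) ℝ} (hΓ : Γ.PosDef)
    (A : Matrix (Fin d) (Fin d) ℝ) :
    ∃ C, 0 ≤ C ∧ ∀ v, sqNormWith Γ⁻¹ (matrixMap A v) ≤ C * sqNormWith Γ⁻¹ v := by
  obtain ⟨C₁, hC₁, h₁⟩ := exists_sqNormWith_le_mul_norm_sq Γ⁻¹
  obtain ⟨C₂, hC₂, h₂⟩ := exists_sqNormWith_le_mul_norm_sq Γ
  let L := (matrixLinearMap A).toContinuousLinearMap
  have h₃ : ∀ v, ‖v‖ ^ 2 ≤ C₂ * sqNormWith Γ⁻¹ v := fun v => by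
    rcases eq_or_ne v 0 with rfl | hv
    · simp [sqNormWith]
    · have hv' : 0 < ‖v‖ ^ 2 := by positivity
      have := inner_sq_le_sqNormWith_mul_sqNormWith hΓ v v
      rw [real_inner_self_eq_norm_sq] at this
      have h4 := this.trans (mul_le_mul_of_nonneg_left (h₂ v)
        (sqNormWith_nonneg hΓ.inv.posSemidef v))
      refine le_of_mul_le_mul_right ?_ hv'
      linarith
  refine ⟨C₁ * ‖L‖ ^ 2 * C₂, by positivity, fun v => ?_⟩
  calc sqNormWith Γ⁻¹ (matrixMap A v) ≤ C₁ * ‖L v‖ ^ 2 := h₁ _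
    _ ≤ C₁ * (‖L‖ * ‖v‖) ^ 2 := by gcongr; exact L.le_opNorm v
    _ = C₁ * ‖L‖ ^ 2 * ‖v‖ ^ 2 := by ring
    _ ≤ C₁ * ‖L‖ ^ 2 * (C₂ * sqNormWith Γ⁻¹ v) := by gcongr; exact h₃ v
    _ = _ := by ring

open scoped MatrixOrder Matrix.Norms.L2Operator in
/-- A factorisation `Γ = Sᵀ S` turns `‖·‖_Γ` into the Euclidean norm. -/
theorem exists_sqNormWith_eq_norm_sq {Γ : Matrix (Fin d) (Fin d) ℝ} (hΓ : Γ.PosDef) :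
    ∃ S : Matrix (Fin d) (Fin d) ℝ, ∀ v, sqNormWith Γ v = ‖matrixMap S v‖ ^ 2 := by
  obtain ⟨S, hS⟩ := CStarAlgebra.nonneg_iff_eq_star_mul_self.1
    (Matrix.nonneg_iff_posSemidef.2 hΓ.posSemidef)
  refine ⟨S, fun v => ?_⟩
  rw [← real_inner_self_eq_norm_sq, ← inner_matrixMap_transpose, hS]
  simp [sqNormWith, EuclideanSpace.inner_eq_star_dotProduct, matrixMap,
    Matrix.star_eq_conjTranspose]

/-- A subspace is the image of a Euclidean space under a linear map that is isometric for the norm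
`‖·‖_Γ`. -/
theorem exists_linearMap_sqNormWith_eq {Γ : Matrix (Fin d) (Fin d) ℝ} (hΓ : Γ.PosDef)
    (K : Submodule ℝ (EuclideanSpace ℝ (Fin d))) :
    ∃ (k : ℕ) (A : EuclideanSpace ℝ (Fin k) →ₗ[ℝ] EuclideanSpace ℝ (Fin d)),
      Function.Injective A ∧ LinearMap.range A = K ∧ ∀ z, sqNormWith Γ (A z) = ‖z‖ ^ 2 := by
  obtain ⟨S, hS⟩ := exists_sqNormWith_eq_norm_sq hΓ
  have hinj : Function.Injective (matrixLinearMap S) := by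
    refine (injective_iff_map_eq_zero _).2 fun v hv => ?_
    by_contra hne
    have hpos : 0 < sqNormWith Γ v := by
      have := hΓ.dotProduct_mulVec_pos (x := v.ofLp) (by simpa using hne)
      simpa [sqNormWith] using this
    have hv' : matrixMap S v = 0 := hv
    rw [hS, hv'] at hpos
    simp at hpos
  let K' := K.map (matrixLinearMap S)
  let e : K ≃ₗ[ℝ] K' := K.equivMapOfInjective _ hinj
  let b := (stdOrthonormalBasis ℝ K').repr
  let e' : EuclideanSpace ℝ (Fin (Module.finrank ℝ K')) ≃ₗ[ℝ] K :=
    b.symm.toLinearEquiv.trans e.symm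
  refine ⟨_, K.subtype ∘ₗ e'.toLinearMap, ?_, ?_, fun z => ?_⟩
  · exact K.injective_subtype.comp e'.injective
  · rw [LinearMap.range_comp, LinearEquiv.range, Submodule.map_top, Submodule.range_subtype]
  · have h1 : matrixMap S (e' z : EuclideanSpace ℝ (Fin d)) = (b.symm z : K') := by
      have : ((e (e' z) : K') : EuclideanSpace ℝ (Fin d)) = (b.symm z : K') := by
        simp [e']
      exact this
    change sqNormWith Γ (e' z : EuclideanSpace ℝ (Fin d)) = _
    rw [hS, h1, Submodule.norm_coe, b.symm.norm_map]

/-! ### Convexity from the Hessian -/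

theorem dotProduct_hessianMatrix_mulVec {V : EuclideanSpace ℝ (Fin d) → ℝ} (hV : ContDiff ℝ 2 V)
    (x v : EuclideanSpace ℝ (Fin d)) :
    v.ofLp ⬝ᵥ (hessianMatrix V x *ᵥ v.ofLp) = fderiv ℝ (fderiv ℝ V) x v v := by
  have hd : Differentiable ℝ (fderiv ℝ V) :=
    (hV.fderiv_right (m := 1) (by norm_num)).differentiable (by norm_num)
  have hentry : ∀ i j, hessianMatrix V x i j
      = fderiv ℝ (fderiv ℝ V) x (EuclideanSpace.single i 1) (EuclideanSpace.single j 1) := by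
    intro i j
    have := ((hd x).hasFDerivAt.clm_apply
      (hasFDerivAt_const (EuclideanSpace.single j (1 : ℝ)) x)).fderiv
    simp only [hessianMatrix, Matrix.of_apply]
    rw [this]
    simp
  have hv : v = ∑ i, v i • EuclideanSpace.single i (1 : ℝ) := by
    ext i
    simp [Finset.sum_apply, Pi.single_apply]
  conv_rhs => rw [hv]
  simp only [map_sum, map_smul, sum_apply, smul_apply,
    smul_eq_mul, dotProduct, Matrix.mulVec, hentry]
  simp_rw [Finset.mul_sum]
  rw [Finset.sum_comm]
  refine Finset.sum_congr rfl fun i _ => Finset.sum_congr rfl fun j _ => ?_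
  ring

/-- Strong convexity with respect to `‖·‖_Γ`: on the line through `y` and `x` the second derivative
of `V` is at least `‖x - y‖²_Γ`, so subtracting the quadratic term leaves a convex function. -/
theorem add_sqNormWith_le_of_hessianMatrix {V : EuclideanSpace ℝ (Fin d) → ℝ}
    (hV : ContDiff ℝ 2 V) {Γ : Matrix (Fin d) (Fin d) ℝ}
    (hΓ : ∀ x, (hessianMatrix V x - Γ).PosSemidef) (x y : EuclideanSpace ℝ (Fin d)) {t s : ℝ}
    (ht : 0 ≤ t) (hs : 0 ≤ s) (hts : t + s = 1) :
    V (t • x + s • y) + t * s / 2 * sqNormWith Γ (x - y) ≤ t * V x + s * V y := by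
  set w := x - y
  set q := sqNormWith Γ w
  have hd1 : Differentiable ℝ V := hV.differentiable (by norm_num)
  have hd2 : Differentiable ℝ (fderiv ℝ V) :=
    (hV.fderiv_right (m := 1) (by norm_num)).differentiable (by norm_num)
  have hline : ∀ τ : ℝ, HasDerivAt (fun τ : ℝ => y + τ • w) w τ := fun τ => by
    simpa using ((hasDerivAt_id τ).smul_const w).const_add y
  let φ : ℝ → ℝ := fun τ => V (y + τ • w) - q / 2 * τ ^ 2
  have hφ1 : ∀ τ, HasDerivAt φ (fderiv ℝ V (y + τ • w) w - q * τ) τ := fun τ => by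
    have h1 := (hd1 (y + τ • w)).hasFDerivAt.comp_hasDerivAt τ (hline τ)
    have h2 := ((hasDerivAt_id τ).pow 2).const_mul (q / 2)
    refine (h1.sub h2).congr_deriv ?_
    simp
    ring
  have hφ2 : ∀ τ, HasDerivAt (fun τ : ℝ => fderiv ℝ V (y + τ • w) w - q * τ)
      (fderiv ℝ (fderiv ℝ V) (y + τ • w) w w - q) τ := fun τ => by
    have h1 := (hd2 (y + τ • w)).hasFDerivAt.comp_hasDerivAt τ (hline τ)
    have h2 := (h1.clm_apply (hasDerivAt_const τ w)).sub ((hasDerivAt_id τ).const_mul q)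
    refine h2.congr_deriv ?_
    simp
  have hderiv : deriv φ = fun τ => fderiv ℝ V (y + τ • w) w - q * τ := funext fun τ => (hφ1 τ).deriv
  have hconv : ConvexOn ℝ Set.univ φ := by
    refine convexOn_of_deriv2_nonneg' convex_univ
      (fun τ _ => (hφ1 τ).differentiableAt.differentiableWithinAt)
      (fun τ _ => by rw [hderiv]; exact (hφ2 τ).differentiableAt.differentiableWithinAt)
      fun τ _ => ?_
    rw [Function.iterate_succ, Function.iterate_one, Function.comp_apply, hderiv, (hφ2 τ).deriv,
      ← dotProduct_hessianMatrix_mulVec hV]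
    have := (hΓ (y + τ • w)).dotProduct_mulVec_nonneg w.ofLp
    rw [star_trivial, Matrix.sub_mulVec, dotProduct_sub] at this
    exact this
  have key := hconv.2 (Set.mem_univ 1) (Set.mem_univ 0) ht hs hts
  have e1 : y + (1 : ℝ) • w = x := by simp [w]
  have e2 : y + t • w = t • x + s • y := by
    simp only [w]
    rw [show s = 1 - t by linarith]
    module
  simp only [smul_eq_mul, mul_one, mul_zero, add_zero, φ, e1, e2, zero_smul, one_pow] at key
  have e3 : t * s / 2 * q = q / 2 * t - q / 2 * t ^ 2 := by
    rw [show s = 1 - t by linarith]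
    ring
  rw [e3]
  linarith

end QuadraticForm

/-! ### The fibres of the projector -/

section Fibre

theorem measurable_gibbs_density {k : ℕ} {W : EuclideanSpace ℝ (Fin k) → ℝ} (hW : Measurable W) :
    Measurable fun x => ENNReal.ofReal (Real.exp (-W x)) := by
  fun_prop

theorem lintegral_gibbs {k : ℕ} {W : EuclideanSpace ℝ (Fin k) → ℝ} (hW : Measurable W)
    {F : EuclideanSpace ℝ (Fin k) → ENNReal} (hF : Measurable F) :
    ∫⁻ x, F x ∂gibbs W = ∫⁻ x, ENNReal.ofReal (Real.exp (-W x)) * F x :=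
  lintegral_withDensity_eq_lintegral_mul _ (measurable_gibbs_density hW) hF

variable {d k : ℕ} {Γ : Matrix (Fin d) (Fin d) ℝ}
  {A : EuclideanSpace ℝ (Fin k) →ₗ[ℝ] EuclideanSpace ℝ (Fin d)}

theorem strongConvexOn_comp_add_linearMap {V : EuclideanSpace ℝ (Fin d) → ℝ}
    (hV : ContDiff ℝ 2 V) (hΓ : ∀ x, (hessianMatrix V x - Γ).PosSemidef)
    (hA : ∀ z, sqNormWith Γ (A z) = ‖z‖ ^ 2) (y : EuclideanSpace ℝ (Fin d)) :
    StrongConvexOn Set.univ 1 (fun z => V (y + A z)) := by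
  refine ⟨convex_univ, fun z _ z' _ t s ht hs hts => ?_⟩
  have h := add_sqNormWith_le_of_hessianMatrix hV hΓ (y + A z) (y + A z') ht hs hts
  have e1 : t • (y + A z) + s • (y + A z') = y + A (t • z + s • z') := by
    rw [map_add, map_smul, map_smul, show s = 1 - t by linarith]
    module
  rw [e1, add_sub_add_left_eq_sub, ← map_sub, hA] at h
  simp only [smul_eq_mul]
  linarith

theorem norm_fderiv_comp_add_linearMap_sq_le (hΓ : Γ.PosDef)
    (hA : ∀ z, sqNormWith Γ (A z) = ‖z‖ ^ 2) {h : EuclideanSpace ℝ (Fin d) → ℝ}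
    (hh : Differentiable ℝ h) (y u : EuclideanSpace ℝ (Fin d)) (z : EuclideanSpace ℝ (Fin k))
    (hu : ∀ w, fderiv ℝ h (y + A z) (A w) = inner ℝ u (A w)) :
    ‖fderiv ℝ (fun z => h (y + A z)) z‖ ^ 2 ≤ sqNormWith Γ⁻¹ u := by
  have hq := sqNormWith_nonneg hΓ.inv.posSemidef u
  have hAd : HasFDerivAt (fun z => y + A z) A.toContinuousLinearMap z :=
    A.toContinuousLinearMap.hasFDerivAt.const_add y
  have hd : HasFDerivAt (fun z => h (y + A z)) _ z := (hh (y + A z)).hasFDerivAt.comp z hAd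
  rw [hd.fderiv]
  refine (Real.le_sqrt (norm_nonneg _) hq).1 ?_
  refine ContinuousLinearMap.opNorm_le_bound _ (Real.sqrt_nonneg _) fun w => ?_
  have e : (fderiv ℝ h (y + A z)).comp A.toContinuousLinearMap w = inner ℝ u (A w) := hu w
  rw [e, Real.norm_eq_abs]
  refine abs_le_of_sq_le_sq ?_ (by positivity)
  rw [mul_pow, Real.sq_sqrt hq, ← hA]
  exact inner_sq_le_sqNormWith_mul_sqNormWith hΓ u (A w)

theorem inner_gradient {h : EuclideanSpace ℝ (Fin d) → ℝ} (x v : EuclideanSpace ℝ (Fin d)) :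
    inner ℝ (∇ h x) v = fderiv ℝ h x v := by
  rw [gradient, InnerProductSpace.toDual_symm_apply]

theorem continuous_gradient {h : EuclideanSpace ℝ (Fin d) → ℝ} (hh : ContDiff ℝ 1 h) :
    Continuous (∇ h) :=
  (InnerProductSpace.toDual ℝ (EuclideanSpace ℝ (Fin d))).symm.continuous.comp
    (hh.continuous_fderiv (by norm_num))

/-- A linear change of variables, with an unspecified positive constant in place of the
determinant. -/
theorem exists_lintegral_eq_mul_lintegral_comp {E F : Type*} [NormedAddCommGroup E]
    [NormedSpace ℝ E] [FiniteDimensional ℝ E] [MeasurableSpace E] [BorelSpace E]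
    [NormedAddCommGroup F] [NormedSpace ℝ F] [MeasurableSpace F] [BorelSpace F]
    (μ : Measure E) [μ.IsAddHaarMeasure] (ν : Measure F) [ν.IsAddHaarMeasure] (L : F ≃L[ℝ] E) :
    ∃ c : ENNReal, c ≠ 0 ∧ c ≠ ⊤ ∧ ∀ f : E → ENNReal, Measurable f →
      ∫⁻ x, f x ∂μ = c * ∫⁻ y, f (L y) ∂ν := by
  have : ProperSpace E := FiniteDimensional.proper_real E
  have hc := Measure.isAddLeftInvariant_eq_smul μ (ν.map L)
  refine ⟨μ.addHaarScalarFactor (ν.map L), ?_, ENNReal.coe_ne_top, fun f hf => ?_⟩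
  · rw [Ne, ENNReal.coe_eq_zero]
    intro h0
    rw [h0, zero_smul] at hc
    exact NeZero.ne μ hc
  · conv_lhs => rw [hc]
    rw [lintegral_smul_measure, lintegral_map hf L.continuous.measurable]
    rfl

/-- The logarithmic Sobolev inequality on the whole space, in coordinates isometric for `‖·‖_Γ`,
gives the square integrability of `h`. -/
theorem integrable_sq_gibbs {V : EuclideanSpace ℝ (Fin d) → ℝ} (hV : ContDiff ℝ 2 V)
    (hΓ : Γ.PosDef) (hVΓ : ∀ x, (hessianMatrix V x - Γ).PosSemidef)
    (hfin : gibbs V Set.univ ≠ ⊤) {h : EuclideanSpace ℝ (Fin d) → ℝ} (hh : ContDiff ℝ 1 h)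
    (hD : ∫⁻ x, ENNReal.ofReal (sqNormWith Γ⁻¹ (∇ h x)) ∂gibbs V ≠ ⊤) :
    Integrable (fun x => h x ^ 2) (gibbs V) := by
  obtain ⟨k, A, hinj, hrange, hA⟩ := exists_linearMap_sqNormWith_eq hΓ ⊤
  let L := (LinearEquiv.ofBijective A
    ⟨hinj, LinearMap.range_eq_top.1 hrange⟩).toContinuousLinearEquiv
  have hL : ∀ z, L z = 0 + A z := fun z => (zero_add (A z)).symm
  obtain ⟨c, hc0, hctop, hc⟩ := exists_lintegral_eq_mul_lintegral_comp volume volume L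
  have hAc : Continuous A := A.continuous_of_finiteDimensional
  have hVc : Continuous V := hV.continuous
  have hhc : Continuous h := hh.continuous
  have hWc : Continuous fun z => V (0 + A z) := by fun_prop
  have hgib : ∀ F : EuclideanSpace ℝ (Fin d) → ENNReal, Measurable F →
      ∫⁻ x, F x ∂gibbs V = c * ∫⁻ z, F (0 + A z) ∂gibbs (fun z => V (0 + A z)) := by
    intro F hF
    have hprod : Measurable fun x => ENNReal.ofReal (Real.exp (-V x)) * F x :=
      (measurable_gibbs_density hVc.measurable).mul hF
    rw [lintegral_gibbs hVc.measurable hF, lintegral_gibbs hWc.measurable (by fun_prop),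
      hc _ hprod]
    simp only [hL]
  have hSm : Measurable fun x => ENNReal.ofReal (sqNormWith Γ⁻¹ (∇ h x)) :=
    ((continuous_sqNormWith _).comp (continuous_gradient hh)).measurable.ennreal_ofReal
  have h1 : gibbs (fun z => V (0 + A z)) Set.univ ≠ ⊤ := by
    intro htop
    have := hgib (fun _ => 1) measurable_const
    rw [lintegral_one, lintegral_one, htop, ENNReal.mul_top hc0] at this
    exact hfin this
  have h2 : ∫⁻ z, ENNReal.ofReal (‖fderiv ℝ (fun z => h (0 + A z)) z‖ ^ 2)
      ∂gibbs (fun z => V (0 + A z)) ≠ ⊤ := by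
    have h3 : ∫⁻ z, ENNReal.ofReal (sqNormWith Γ⁻¹ (∇ h (0 + A z)))
        ∂gibbs (fun z => V (0 + A z)) ≠ ⊤ := by
      intro htop
      have := hgib _ hSm
      rw [htop, ENNReal.mul_top hc0] at this
      exact hD this
    refine ne_top_of_le_ne_top h3 (lintegral_mono fun z => ENNReal.ofReal_le_ofReal ?_)
    exact norm_fderiv_comp_add_linearMap_sq_le hΓ hA (hh.differentiable (by norm_num)) 0 _ z
      fun w => (inner_gradient _ _).symm
  have hf : ContDiff ℝ 1 fun z => h (0 + A z) :=
    hh.comp (contDiff_const.add A.toContinuousLinearMap.contDiff)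
  have h4 := (integrable_sq_and_lintegral_entDensity_le hWc.measurable
    (strongConvexOn_comp_add_linearMap hV hVΓ hA 0) h1 hf h2).1
  refine (lintegral_ofReal_ne_top_iff_integrable (by fun_prop)
    (.of_forall fun x => sq_nonneg _)).1 ?_
  rw [hgib _ (by fun_prop)]
  exact ENNReal.mul_ne_top hctop ((lintegral_ofReal_ne_top_iff_integrable (by fun_prop)
    (.of_forall fun x => sq_nonneg _)).2 h4)

/-- The conditional inequality for the unperturbed measure: `G` is the fibrewise mean of `h ^ 2`
over the affine subspaces parallel to the kernel of the projector. On each fibre `V` is strongly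
convex for the restriction of `Γ`, and the derivative of `h` along the kernel only sees
`(1 - Pᵀ) ∇ h`. -/
theorem exists_measurable_lintegral_entDensity_le {V : EuclideanSpace ℝ (Fin d) → ℝ}
    (hV : ContDiff ℝ 2 V) (hΓ : Γ.PosDef) (hVΓ : ∀ x, (hessianMatrix V x - Γ).PosSemidef)
    (hfin : gibbs V Set.univ ≠ ⊤) {P : Matrix (Fin d) (Fin d) ℝ} (hP : P * P = P)
    {h : EuclideanSpace ℝ (Fin d) → ℝ} (hh : ContDiff ℝ 1 h)
    (hD : ∫⁻ x, ENNReal.ofReal (sqNormWith Γ⁻¹ (matrixMap (1 - Pᵀ) (∇ h x))) ∂gibbs V ≠ ⊤) :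
    ∃ G : EuclideanSpace ℝ (Fin d) → ℝ, Measurable[sigmaOf P] G ∧ (∀ x, 0 ≤ G x) ∧
      (∀ᵐ x ∂gibbs V, G x = 0 → h x ^ 2 = 0) ∧
      ∫⁻ x, ENNReal.ofReal (entDensity (h x ^ 2) (G x)) ∂gibbs V
        ≤ 2 * ∫⁻ x, ENNReal.ofReal (sqNormWith Γ⁻¹ (matrixMap (1 - Pᵀ) (∇ h x))) ∂gibbs V := by
  set S : EuclideanSpace ℝ (Fin d) → ENNReal :=
    fun x => ENNReal.ofReal (sqNormWith Γ⁻¹ (matrixMap (1 - Pᵀ) (∇ h x))) with hS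
  have hSm : Measurable S := ((continuous_sqNormWith _).comp ((continuous_matrixMap _).comp
    (continuous_gradient hh))).measurable.ennreal_ofReal
  let p := matrixLinearMap P
  have hpp : ∀ x, p (p x) = p x := fun x => by
    change matrixMap P (matrixMap P x) = matrixMap P x
    simp [matrixMap, Matrix.mulVec_mulVec, hP]
  obtain ⟨k, A, hinj, hrange, hA⟩ := exists_linearMap_sqNormWith_eq hΓ (LinearMap.ker p)
  have hpA : ∀ z, p (A z) = 0 := fun z => by
    have : A z ∈ LinearMap.ker p := hrange ▸ LinearMap.mem_range_self A z
    exact this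
  let R := LinearMap.range p
  have hpR : ∀ y : R, p y = y := by
    rintro ⟨_, x, rfl⟩
    exact hpp x
  -- Coordinates adapted to the decomposition into the range and the kernel of `P`.
  let l : (R × EuclideanSpace ℝ (Fin k)) →ₗ[ℝ] EuclideanSpace ℝ (Fin d) := R.subtype.coprod A
  have hl : ∀ y z, l (y, z) = y + A z := fun y z => by simp [l]
  have hlinj : Function.Injective l := by
    refine (injective_iff_map_eq_zero _).2 fun ⟨y, z⟩ h0 => ?_
    rw [hl] at h0
    have hy : (y : EuclideanSpace ℝ (Fin d)) = 0 := by
      have := congrArg p h0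
      rwa [map_add, hpA, hpR, map_zero, add_zero] at this
    rw [hy, zero_add] at h0
    have hz : z = 0 := hinj (by rw [h0, map_zero])
    simp [hz, Submodule.coe_eq_zero.1 hy]
  have hlsurj : Function.Surjective l := fun x => by
    have hker : x - p x ∈ LinearMap.range A := by
      rw [hrange, LinearMap.mem_ker, map_sub, hpp, sub_self]
    obtain ⟨z, hz⟩ := hker
    exact ⟨(⟨p x, x, rfl⟩, z), by rw [hl, hz]; simp⟩
  let L := (LinearEquiv.ofBijective l ⟨hlinj, hlsurj⟩).toContinuousLinearEquiv
  have hL : ∀ y z, L (y, z) = y + A z := hl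
  obtain ⟨c, hc0, -, hc⟩ := exists_lintegral_eq_mul_lintegral_comp
    (volume : Measure (EuclideanSpace ℝ (Fin d)))
    ((volume : Measure R).prod (volume : Measure (EuclideanSpace ℝ (Fin k)))) L
  have hAc : Continuous A := A.continuous_of_finiteDimensional
  have hVc : Continuous V := hV.continuous
  have hhc : Continuous h := hh.continuous
  have hadd : Measurable fun q : R × EuclideanSpace ℝ (Fin k) =>
      (q.1 : EuclideanSpace ℝ (Fin d)) + A q.2 := by
    refine Continuous.measurable ?_
    fun_prop
  let W : R → EuclideanSpace ℝ (Fin k) → ℝ := fun y z => V (y + A z)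
  have hWm : ∀ y, Measurable (W y) := fun y => by
    refine Continuous.measurable ?_
    fun_prop
  have hdens : Measurable fun q : R × EuclideanSpace ℝ (Fin k) =>
      ENNReal.ofReal (Real.exp (-W q.1 q.2)) :=
    (measurable_gibbs_density hVc.measurable).comp hadd
  have hfibm : ∀ F : R × EuclideanSpace ℝ (Fin k) → ENNReal, Measurable F →
      Measurable fun y => ∫⁻ z, F (y, z) ∂gibbs (W y) := by
    intro F hF
    have : ∀ y, ∫⁻ z, F (y, z) ∂gibbs (W y)
        = ∫⁻ z, ENNReal.ofReal (Real.exp (-W y z)) * F (y, z) := fun y =>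
      lintegral_gibbs (hWm y) (by fun_prop)
    simp_rw [this]
    exact (hdens.mul hF).lintegral_prod_right'
  have hfub : ∀ F : EuclideanSpace ℝ (Fin d) → ENNReal, Measurable F →
      ∫⁻ x, F x ∂gibbs V = c * ∫⁻ y : R, ∫⁻ z, F (y + A z) ∂gibbs (W y) := by
    intro F hF
    have hprod : Measurable fun x => ENNReal.ofReal (Real.exp (-V x)) * F x :=
      (measurable_gibbs_density hVc.measurable).mul hF
    have hprodL : Measurable fun q => ENNReal.ofReal (Real.exp (-V (L q))) * F (L q) :=
      hprod.comp L.continuous.measurable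
    rw [lintegral_gibbs hVc.measurable hF, hc _ hprod, lintegral_prod _ hprodL.aemeasurable]
    congr 1
    refine lintegral_congr fun y => ?_
    rw [lintegral_gibbs (hWm y) (by fun_prop)]
    simp only [hL, W]
  have hae : ∀ F : EuclideanSpace ℝ (Fin d) → ENNReal, Measurable F →
      ∫⁻ x, F x ∂gibbs V ≠ ⊤ → ∀ᵐ y : R, ∫⁻ z, F (y + A z) ∂gibbs (W y) ≠ ⊤ := by
    intro F hF htop
    rw [hfub F hF] at htop
    have h1 : ∫⁻ y : R, ∫⁻ z, F (y + A z) ∂gibbs (W y) ≠ ⊤ := fun h1 => by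
      rw [h1, ENNReal.mul_top hc0] at htop
      exact htop rfl
    filter_upwards [ae_lt_top (hfibm _ (hF.comp hadd)) h1] with y hy using hy.ne
  -- The mean of `h ^ 2` over the fibre through `y`.
  let g : R → ℝ := fun y =>
    ((∫⁻ z, ENNReal.ofReal (h (y + A z) ^ 2) ∂gibbs (W y)) / gibbs (W y) Set.univ).toReal
  have hgm : Measurable g := by
    have h1 := hfibm (fun q => ENNReal.ofReal (h (q.1 + A q.2) ^ 2))
      ((hhc.measurable.comp hadd).pow_const 2).ennreal_ofReal
    have h2 := hfibm (fun _ => 1) measurable_const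
    simp only [lintegral_one] at h2
    exact (h1.div h2).ennreal_toReal
  let G : EuclideanSpace ℝ (Fin d) → ℝ := fun x => g (L.symm x).1
  have hGm : Measurable G := hgm.comp (measurable_fst.comp L.symm.continuous.measurable)
  have hGL : ∀ (y : R) z, G (y + A z) = g y := fun y z => by
    simp only [G]
    rw [← hL, L.symm_apply_apply]
  -- `G` depends on `x` only through `P x`, which makes it `σ(P)`-measurable.
  have hGP : ∀ x, G (matrixMap P x) = G x := fun x => by
    obtain ⟨⟨y, z⟩, rfl⟩ := hlsurj x
    have e : matrixMap P (l (y, z)) = y + A 0 := by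
      change p (l (y, z)) = _
      rw [hl, map_add, hpA, hpR, map_zero]
    rw [e, hl, hGL, hGL]
  -- The inequality on almost every fibre.
  have hfibre : ∀ᵐ y : R, gibbs (W y) Set.univ ≠ ⊤ ∧
      Integrable (fun z => h (y + A z) ^ 2) (gibbs (W y)) ∧
      ∫⁻ z, ENNReal.ofReal (entDensity (h (y + A z) ^ 2) (g y)) ∂gibbs (W y)
        ≤ 2 * ∫⁻ z, S (y + A z) ∂gibbs (W y) := by
    have h1 := hae (fun _ => 1) measurable_const (by rwa [lintegral_one])
    simp only [lintegral_one] at h1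
    filter_upwards [h1, hae S hSm hD] with y hy1 hy2
    have hle : ∀ z, ENNReal.ofReal (‖fderiv ℝ (fun z => h (y + A z)) z‖ ^ 2) ≤ S (y + A z) := by
      intro z
      refine ENNReal.ofReal_le_ofReal (norm_fderiv_comp_add_linearMap_sq_le hΓ hA
        (hh.differentiable (by norm_num)) y _ z fun w => ?_)
      have e : (1 - Pᵀ : Matrix (Fin d) (Fin d) ℝ) = (1 - P)ᵀ := by
        rw [Matrix.transpose_sub, Matrix.transpose_one]
      have e2 : matrixMap (1 - P) (A w) = A w := by
        have h0 : matrixMap P (A w) = 0 := hpA w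
        have h3 : matrixMap (1 - P) (A w) = A w - matrixMap P (A w) := by
          simp [matrixMap, Matrix.sub_mulVec]
        rw [h3, h0, sub_zero]
      rw [e, inner_matrixMap_transpose, e2, inner_gradient]
    have hf : ContDiff ℝ 1 fun z => h (y + A z) :=
      hh.comp (contDiff_const.add A.toContinuousLinearMap.contDiff)
    have h3 := integrable_sq_and_lintegral_entDensity_le (hWm y)
      (strongConvexOn_comp_add_linearMap hV hVΓ hA y) hy1 hf
      (ne_top_of_le_ne_top hy2 (lintegral_mono hle))
    exact ⟨hy1, h3.1, h3.2.trans (by gcongr; exact hle _)⟩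
  refine ⟨G, ?_, fun x => ENNReal.toReal_nonneg, ?_, ?_⟩
  · have : G = G ∘ matrixMap P := funext fun x => (hGP x).symm
    rw [this]
    exact hGm.comp (comap_measurable (matrixMap P))
  · let F : EuclideanSpace ℝ (Fin d) → ENNReal :=
      (G ⁻¹' {0}).indicator fun x => ENNReal.ofReal (h x ^ 2)
    have hFm : Measurable F :=
      (hhc.measurable.pow_const 2).ennreal_ofReal.indicator (hGm (measurableSet_singleton 0))
    have hF0 : ∫⁻ x, F x ∂gibbs V = 0 := by
      rw [hfub F hFm]
      have : ∫⁻ y : R, ∫⁻ z, F (y + A z) ∂gibbs (W y) = ∫⁻ y : R, 0 := by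
        refine lintegral_congr_ae ?_
        filter_upwards [hfibre] with y hy
        by_cases hgy : g y = 0
        · have hFz : ∀ z, F (y + A z) = ENNReal.ofReal (h (y + A z) ^ 2) := fun z =>
            Set.indicator_of_mem (by simp [hGL, hgy]) _
          simp_rw [hFz]
          have hne : ∫⁻ z, ENNReal.ofReal (h (y + A z) ^ 2) ∂gibbs (W y) ≠ ⊤ :=
            (lintegral_ofReal_ne_top_iff_integrable (by fun_prop)
              (.of_forall fun x => sq_nonneg _)).2 hy.2.1
          by_cases h0 : gibbs (W y) Set.univ = 0
          · rw [Measure.measure_univ_eq_zero.1 h0, lintegral_zero_measure]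
          · rcases (ENNReal.toReal_eq_zero_iff _).1 hgy with h1 | h1
            · exact (ENNReal.div_eq_zero_iff.1 h1).resolve_right hy.1
            · exact absurd h1 (ENNReal.div_ne_top hne h0)
        · have hFz : ∀ z, F (y + A z) = 0 := fun z =>
            Set.indicator_of_notMem (by simp [hGL, hgy]) _
          simp [hFz]
      rw [this, lintegral_zero, mul_zero]
    filter_upwards [(lintegral_eq_zero_iff hFm).1 hF0] with x hx hGx
    have hFx : F x = ENNReal.ofReal (h x ^ 2) := Set.indicator_of_mem (by simpa using hGx) _
    rw [hFx, Pi.zero_apply, ENNReal.ofReal_eq_zero] at hx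
    exact le_antisymm hx (sq_nonneg _)
  · have hEm : Measurable fun x => ENNReal.ofReal (entDensity (h x ^ 2) (G x)) :=
      (measurable_entDensity.comp ((hhc.measurable.pow_const 2).prodMk hGm)).ennreal_ofReal
    rw [hfub _ hEm, hfub S hSm, mul_left_comm]
    gcongr c * ?_
    have hSf : Measurable fun y : R => ∫⁻ z, S (y + A z) ∂gibbs (W y) :=
      hfibm (fun q => S (q.1 + A q.2)) (hSm.comp hadd)
    rw [← lintegral_const_mul _ hSf]
    refine lintegral_mono_ae ?_
    filter_upwards [hfibre] with y hy
    simpa only [hGL] using hy.2.2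

end Fibre

/-! ### The bounded perturbation -/

section Perturbation

variable {d : ℕ} {μ : Measure (EuclideanSpace ℝ (Fin d))} {V Ψ : EuclideanSpace ℝ (Fin d) → ℝ}
  {Γ : Matrix (Fin d) (Fin d) ℝ} {κ : ℝ}

/-- A bounded perturbation changes the measure by at most constant factors `α` and `β`, whose
product is at most the exponential of the oscillation of the perturbation. -/
theorem IsPerturbedStronglyLogConcave.exists_le_smul_gibbs
    (hμ : IsPerturbedStronglyLogConcave μ V Ψ Γ κ) :
    ∃ α β : ENNReal, α ≠ ⊤ ∧ β ≠ ⊤ ∧ α * β ≤ ENNReal.ofReal κ ∧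
      μ ≤ α • gibbs V ∧ gibbs V ≤ β • μ := by
  obtain ⟨c, hc, hdens⟩ := hμ.density
  have hVm : Measurable V := hμ.contDiff.continuous.measurable
  set a := ⨅ x, Ψ x
  set b := ⨆ x, Ψ x
  have ha : ∀ x, a ≤ Ψ x := ciInf_le hμ.bddBelow
  have hb : ∀ x, Ψ x ≤ b := le_ciSup hμ.bddAbove
  have hdm : Measurable fun x => ENNReal.ofReal (Real.exp (-V x)) := by fun_prop
  refine ⟨ENNReal.ofReal (c * Real.exp (-a)), ENNReal.ofReal (c⁻¹ * Real.exp b),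
    ENNReal.ofReal_ne_top, ENNReal.ofReal_ne_top, ?_, ?_, ?_⟩
  · rw [← ENNReal.ofReal_mul (by positivity)]
    refine ENNReal.ofReal_le_ofReal (le_trans (le_of_eq ?_) hμ.exp_osc_le)
    rw [show (⨆ x, Ψ x) - ⨅ x, Ψ x = b + -a from sub_eq_add_neg b a, Real.exp_add]
    field_simp
  · rw [hdens, gibbs, ← withDensity_smul _ hdm]
    refine withDensity_mono (.of_forall fun x => ?_)
    rw [Pi.smul_apply, smul_eq_mul, ← ENNReal.ofReal_mul (by positivity)]
    refine ENNReal.ofReal_le_ofReal ?_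
    rw [mul_assoc, ← Real.exp_add]
    gcongr
    linarith [ha x]
  · rw [hdens, gibbs, ← withDensity_smul' _ _ ENNReal.ofReal_ne_top]
    refine withDensity_mono (.of_forall fun x => ?_)
    rw [Pi.smul_apply, smul_eq_mul, ← ENNReal.ofReal_mul (by positivity)]
    refine ENNReal.ofReal_le_ofReal ?_
    have : c⁻¹ * Real.exp b * (c * Real.exp (-V x - Ψ x)) = Real.exp (b + (-V x - Ψ x)) := by
      rw [Real.exp_add]
      field_simp
    rw [this]
    gcongr
    linarith [hb x]

end Perturbation

theorem mainTheorem1 {d : ℕ} (μ : Measure (EuclideanSpace ℝ (Fin d))) [IsProbabilityMeasure μ]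
    (V Ψ : EuclideanSpace ℝ (Fin d) → ℝ) (Γ : Matrix (Fin d) (Fin d) ℝ) (κ : ℝ) (hκ : 1 ≤ κ)
    (hμ : IsPerturbedStronglyLogConcave μ V Ψ Γ κ)
    (P : Matrix (Fin d) (Fin d) ℝ) (hP : P * P = P)
    (h : EuclideanSpace ℝ (Fin d) → ℝ) (hh : ContDiff ℝ 1 h)
    (hgrad : Integrable (fun x => sqNormWith Γ⁻¹ (∇ h x)) μ) :
    Integrable (fun x => h x ^ 2) μ ∧
    Integrable (fun x => h x ^ 2 *
      Real.log (h x ^ 2 / (μ[fun y => h y ^ 2 | sigmaOf P]) x)) μ ∧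
    Integrable (fun x => sqNormWith Γ⁻¹ (matrixMap (1 - Pᵀ) (∇ h x))) μ ∧
    ∫ x, h x ^ 2 * Real.log (h x ^ 2 / (μ[fun y => h y ^ 2 | sigmaOf P]) x) ∂μ
      ≤ 2 * κ * ∫ x, sqNormWith Γ⁻¹ (matrixMap (1 - Pᵀ) (∇ h x)) ∂μ := by
  have hΓ := hμ.posDef
  have hhc : Continuous h := hh.continuous
  have hgc := continuous_gradient hh
  have hq := continuous_sqNormWith Γ⁻¹
  have hm : sigmaOf P ≤ (inferInstance : MeasurableSpace (EuclideanSpace ℝ (Fin d))) :=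
    (continuous_matrixMap P).measurable.comap_le
  obtain ⟨α, β, hα, hβ, hαβ, hμα, hμβ⟩ := hμ.exists_le_smul_gibbs
  have hlμ : ∀ f : EuclideanSpace ℝ (Fin d) → ENNReal,
      ∫⁻ x, f x ∂μ ≤ α * ∫⁻ x, f x ∂gibbs V := fun f =>
    (lintegral_mono' hμα le_rfl).trans_eq (lintegral_smul_measure _ _)
  have hlV : ∀ f : EuclideanSpace ℝ (Fin d) → ENNReal,
      ∫⁻ x, f x ∂gibbs V ≤ β * ∫⁻ x, f x ∂μ := fun f =>
    (lintegral_mono' hμβ le_rfl).trans_eq (lintegral_smul_measure _ _)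
  have hfin : gibbs V Set.univ ≠ ⊤ := by
    refine ne_top_of_le_ne_top hβ ((hμβ Set.univ).trans ?_)
    simp
  -- The gradient terms.
  set S : EuclideanSpace ℝ (Fin d) → ℝ :=
    fun x => sqNormWith Γ⁻¹ (matrixMap (1 - Pᵀ) (∇ h x))
  have hSc : Continuous S := hq.comp ((continuous_matrixMap _).comp hgc)
  have hS0 : ∀ x, 0 ≤ S x := fun x => sqNormWith_nonneg hΓ.inv.posSemidef _
  have hSI : Integrable S μ := by
    obtain ⟨C, -, hC⟩ := exists_sqNormWith_inv_matrixMap_le hΓ (1 - Pᵀ)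
    refine (hgrad.const_mul C).mono' hSc.aestronglyMeasurable (.of_forall fun x => ?_)
    rw [Real.norm_eq_abs, abs_of_nonneg (hS0 x)]
    exact hC _
  have hSV : ∫⁻ x, ENNReal.ofReal (S x) ∂gibbs V ≠ ⊤ :=
    ne_top_of_le_ne_top (ENNReal.mul_ne_top hβ ((lintegral_ofReal_ne_top_iff_integrable
      hSc.aestronglyMeasurable (.of_forall hS0)).2 hSI)) (hlV _)
  have hgradV : ∫⁻ x, ENNReal.ofReal (sqNormWith Γ⁻¹ (∇ h x)) ∂gibbs V ≠ ⊤ :=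
    ne_top_of_le_ne_top (ENNReal.mul_ne_top hβ ((lintegral_ofReal_ne_top_iff_integrable
      (hq.comp hgc).aestronglyMeasurable
      (.of_forall fun x => sqNormWith_nonneg hΓ.inv.posSemidef _)).2 hgrad)) (hlV _)
  have hI : Integrable (fun x => h x ^ 2) μ :=
    (integrable_sq_gibbs hμ.contDiff hΓ hμ.hessian_ge hfin hh hgradV).of_measure_le_smul hα hμα
  -- The conditional mean under `μ` is compared with that under the unperturbed measure.
  obtain ⟨G, hGm, hG0, hGF, hGent⟩ :=
    exists_measurable_lintegral_entDensity_le hμ.contDiff hΓ hμ.hessian_ge hfin hP hh hSV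
  have hμac : μ ≪ gibbs V := Measure.absolutelyContinuous_of_le_smul hμα
  have hGF' : ∀ᵐ x ∂μ, G x = 0 → h x ^ 2 = 0 := hμac.ae_le hGF
  set M := μ[fun y => h y ^ 2 | sigmaOf P]
  have hent : ∫⁻ x, ENNReal.ofReal (entDensity (h x ^ 2) (M x)) ∂μ
      ≤ ENNReal.ofReal (2 * κ * ∫ x, S x ∂μ) := by
    calc ∫⁻ x, ENNReal.ofReal (entDensity (h x ^ 2) (M x)) ∂μ
        ≤ ∫⁻ x, ENNReal.ofReal (entDensity (h x ^ 2) (G x)) ∂μ :=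
          lintegral_entDensity_condExp_le hm (fun x => sq_nonneg _)
            (hhc.measurable.pow_const 2) hI hGm hG0 hGF'
      _ ≤ α * ∫⁻ x, ENNReal.ofReal (entDensity (h x ^ 2) (G x)) ∂gibbs V := hlμ _
      _ ≤ α * (2 * ∫⁻ x, ENNReal.ofReal (S x) ∂gibbs V) := by gcongr
      _ ≤ α * (2 * (β * ∫⁻ x, ENNReal.ofReal (S x) ∂μ)) := by gcongr; exact hlV _
      _ = 2 * (α * β) * ∫⁻ x, ENNReal.ofReal (S x) ∂μ := by ring
      _ ≤ 2 * ENNReal.ofReal κ * ∫⁻ x, ENNReal.ofReal (S x) ∂μ := by gcongr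
      _ = ENNReal.ofReal (2 * κ * ∫ x, S x ∂μ) := by
          rw [ENNReal.ofReal_mul (by positivity), ENNReal.ofReal_mul zero_le_two,
            ofReal_integral_eq_lintegral_ofReal hSI (.of_forall hS0)]
          simp
  -- The integrand `h² log (h² / M)` is `entDensity (h²) M` plus the term `h² - M` of mean zero.
  have hF0 : 0 ≤ᵐ[μ] fun x => h x ^ 2 := .of_forall fun x => sq_nonneg _
  have hMm : Measurable[sigmaOf P] M := stronglyMeasurable_condExp.measurable
  have hMI : Integrable M μ := integrable_condExp
  have hent0 : 0 ≤ᵐ[μ] fun x => entDensity (h x ^ 2) (M x) := by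
    have hMF : ∀ᵐ x ∂μ, M x = 0 → h x ^ 2 = 0 :=
      (ae_eq_zero_iff_condExp_ae_eq_zero hm hF0 hI (s := M ⁻¹' {0})
        (hMm (measurableSet_singleton 0))).2 (.of_forall fun x hx => hx)
    have hM0 : 0 ≤ᵐ[μ] M := condExp_nonneg hF0
    filter_upwards [hMF, hM0] with x hx hx0
    rcases eq_or_lt_of_le hx0 with h0 | h0
    · simp only [Pi.zero_apply] at h0
      simp [entDensity, ← h0, hx h0.symm]
    · exact entDensity_nonneg (sq_nonneg _) h0
  have hentm : AEStronglyMeasurable (fun x => entDensity (h x ^ 2) (M x)) μ :=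
    (measurable_entDensity.comp ((hhc.measurable.pow_const 2).prodMk
      (hMm.mono hm le_rfl))).aestronglyMeasurable
  have hentI : Integrable (fun x => entDensity (h x ^ 2) (M x)) μ :=
    (lintegral_ofReal_ne_top_iff_integrable hentm hent0).1
      (ne_top_of_le_ne_top ENNReal.ofReal_ne_top hent)
  have heq : ∀ x, h x ^ 2 * Real.log (h x ^ 2 / M x)
      = entDensity (h x ^ 2) (M x) + (h x ^ 2 - M x) := fun x => by
    rw [entDensity]
    ring
  have hdiff : Integrable (fun x => h x ^ 2 - M x) μ := hI.sub hMI
  simp_rw [heq]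
  refine ⟨hI, hentI.add hdiff, hSI, ?_⟩
  have hMint : ∫ x, M x ∂μ = ∫ x, h x ^ 2 ∂μ := integral_condExp hm
  rw [integral_add hentI hdiff, integral_sub hI hMI, hMint, sub_self, add_zero]
  have hS2 : 0 ≤ 2 * κ * ∫ x, S x ∂μ :=
    mul_nonneg (by positivity) (integral_nonneg hS0)
  rwa [← ofReal_integral_eq_lintegral_ofReal hentI hent0, ENNReal.ofReal_le_ofReal_iff hS2] at hent
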